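/- **Setting.** Let $\Lambda$ be the set of pure $\lambda$-terms (up to renaming of bound variables), $(t)u$ the application of $t$ to $u$, and $\simeq_{\beta\eta}$ the $\beta\eta$-equivalence. Let $L$ be a second-order language: function symbols and relation symbols, each with an arity $n\ge 0$; there are infinitely many individual variables and, for each $n\ge 0$, infinitely many $n$-ary relation variables. Terms are built from individual variables and function symbols. Formulas (also called types) are built from atomic formulas $X(a_1,\dots,a_n)$, with $X$ an $n$-ary relation variable or symbol and $a_i$ terms, by $\to$, $\forall x$ ($x$ an individual variable) and $\forall X$ ($X$ a relation variable). Let $E$ be a countable set of equations $a=b$ between terms of $L$; a *particular case* of an equation $a=b$ is an equation $a[u_1/x_1,\dots,u_n/x_n]=b[u_1/x_1,\dots,u_n/x_n]$ or $b[u_1/x_1,\dots,u_n/x_n]=a[u_1/x_1,\dots,u_n/x_n]$ with terms $u_i$. **The system $\mathcal{AF}2_0$.** Contexts $\Gamma$ are finite sets of declarations $x:A$ with distinct $\lambda$-variables $x$. The rules are: (1) $\Gamma\vdash x:A$ if $(x:A)\in\Gamma$; (2) from $\Gamma,x:A\vdash t:B$ infer $\Gamma\vdash\lambda x\,t:A\to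 B$; (3) from $\Gamma\vdash u:A\to B$ and $\Gamma\vdash v:A$ infer $\Gamma\vdash (u)v:B$; (4) from $\Gamma\vdash t:A$ infer $\Gamma\vdash t:\forall x A$ if $x$ is not free in $\Gamma$; (5) from $\Gamma\vdash t:\forall xA$ infer $\Gamma\vdash t:A[u/x]$ for any term $u$; (6) from $\Gamma\vdash t:A$ infer $\Gamma\vdash t:\forall XA$ if $X$ is not free in $\Gamma$; (7$_0$) from $\Gamma\vdash t:\forall XA$ infer $\Gamma\vdash t:A[Y/X]$ for $Y$ a relation variable or a relation symbol of the same arity as $X$; (8) from $\Gamma\vdash t:A[u/x]$ infer $\Gamma\vdash t:A[v/x]$ if $u=v$ is a particular case of an equation of $E$. **The class $\forall_2^+$.** The formulas $\forall_2^+$ and $\forall_2^-$ are defined simultaneously: atomic formulas are both; $B\to A$ is $\forall_2^{+}$ (resp. $\forall_2^-$) if $A$ is $\forall_2^{+}$ (resp. $\forall_2^-$) and $B$ is $\forall_2^{-}$ (resp. $\forall_2^+$); if $A$ is $\forall_2^+$ then $\forall xA$ and $\forall XA$ are $\forall_2^+$; if $A$ is $\forall_2^-$ then $\forall xA$ is $\forall_2^-$,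 and $\forall XA$ is $\forall_2^-$ provided $X$ does not occur in $A$. **Semantics.** A set $G\subseteq\Lambda$ is *saturated* if $u\in G$ and $t\simeq_{\beta\eta}u$ imply $t\in G$. Put $G\to G'=\{u\in\Lambda : (u)t\in G' \text{ for all } t\in G\}$. A set $R$ of saturated sets is *adequate* if it is closed under $\to$ and under arbitrary intersections (including the empty one, so $\Lambda\in R$). A *$\Lambda_{\beta\eta}$-model* $M$ consists of a non-empty set $|M|$, an adequate set $R$, a function $f_M:|M|^n\to|M|$ for each $n$-ary function symbol $f$ and a function $P_M:|M|^n\to R$ for each $n$-ary relation symbol $P$. An interpretation $I$ assigns to each individual variable an element of $|M|$ and to each $n$-ary relation variable a function $|M|^n\to R$. Terms are evaluated as usual, and $|F|_{M,I}$ is defined by $|X(a_1,\dots,a_n)|_{M,I}=I(X)(a_{1,M,I},\dots,a_{n,M,I})$ (with $P_M$ in place of $I(X)$ for a relation symbol $P$), $|F\to G|_{M,I}=|F|_{M,I}\to|G|_{M,I}$, $|\forall xF|_{M,I}=\bigcap_{a\in|M|}|F|_{M,I[x\leftarrow a]}$ and $|\forall XF|_{M,I}=\bigcap_{\Phi:|M|^n\to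 R}|F|_{M,I[X\leftarrow\Phi]}$ ($X$ of arity $n$). $M$ is a *model of $E$* if $a_{M,I}=b_{M,I}$ for every equation $a=b$ of $E$ and every $I$. For a closed formula $A$, $|A|_{M,I}$ does not depend on $I$, and $|A|_{\beta\eta}$ denotes the intersection of the values $|A|_{M}$ over all $\Lambda_{\beta\eta}$-models $M$ of $E$. **Theorem.** Let $A$ be a closed $\forall_2^+$ type and $t$ a $\lambda$-term. Then $t\in|A|_{\beta\eta}$ if and only if there is a $\lambda$-term $t'$ such that $t\simeq_{\beta\eta}t'$ and $\vdash_{\mathcal{AF}2_0}t':A$ (typable with the equations $E$ in the empty context). -/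

import Mathlib

universe u v w

namespace AF2

/-! ### The pure lambda-calculus (terms up to renaming of bound variables, as de Bruijn terms) -/

/-- Pure lambda-terms. Under `k` abstractions the index `k + i` denotes the free variable `i`. -/
inductive Lam : Type
  | var : ℕ → Lam
  | app : Lam → Lam → Lam
  | lam : Lam → Lam

namespace Lam

/-- Extension of a renaming under a binder. -/
def liftRen (ρ : ℕ → ℕ) : ℕ → ℕ
  | 0 => 0
  | k + 1 => ρ k + 1

/-- Renaming of the free variables. -/
def rename : (ℕ → ℕ) → Lam → Lam
  | ρ, var k => var (ρ k)
  | ρ, app t s => app (rename ρ t) (rename ρ s)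
  | ρ, lam t => lam (rename (liftRen ρ) t)

/-- Extension of a substitution under a binder. -/
def liftSub (σ : ℕ → Lam) : ℕ → Lam
  | 0 => var 0
  | k + 1 => rename Nat.succ (σ k)

/-- Simultaneous capture-avoiding substitution. -/
def subst : (ℕ → Lam) → Lam → Lam
  | σ, var k => σ k
  | σ, app t s => app (subst σ t) (subst σ s)
  | σ, lam t => lam (subst (liftSub σ) t)

/-- The substitution of `s` for the variable `0`, the other variables being lowered by one. -/
def single (s : Lam) : ℕ → Lam
  | 0 => s
  | k + 1 => var k

/-- One step of beta-reduction or of eta-reduction, in any context. -/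
inductive Step : Lam → Lam → Prop
  | beta (t s : Lam) : Step (app (lam t) s) (subst (single s) t)
  | eta (t : Lam) : Step (lam (app (rename Nat.succ t) (var 0))) t
  | appL {t t' : Lam} (s : Lam) : Step t t' → Step (app t s) (app t' s)
  | appR (t : Lam) {s s' : Lam} : Step s s' → Step (app t s) (app t s')
  | lam {t t' : Lam} : Step t t' → Step (lam t) (lam t')

/-- Beta-eta-equivalence. -/
def BetaEtaEq : Lam → Lam → Prop := Relation.EqvGen Step

end Lam

/-! ### Second-order formulas

The function and relation symbols of every arity are those of a `FirstOrder.Language`.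
Individual terms are `L.Term ℕ`, the individual variables being natural numbers.
For every arity `n` the relation variables of arity `n` are natural numbers. Formulas are taken up
to renaming of bound variables: the individual quantifier binds the individual variable `0`, the
quantifier over relations of arity `n` binds the relation variable `0` of arity `n`. -/

variable {L : FirstOrder.Language.{u, v}}

/-- The head of an atomic formula: a relation variable or a relation symbol of arity `n`. -/
inductive Head (L : FirstOrder.Language.{u, v}) (n : ℕ) : Type v
  | var : ℕ → Head L n
  | sym : L.Relations n → Head L n

/-- The formulas of the language, which are the types of the typing systems. -/
inductive Formula (L : FirstOrder.Language.{u, v}) : Type (max u v)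
  | atom {n : ℕ} (H : Head L n) (ts : Fin n → L.Term ℕ) : Formula L
  | imp (A B : Formula L) : Formula L
  | allInd (A : Formula L) : Formula L
  | allRel (n : ℕ) (A : Formula L) : Formula L

/-- Extension of a substitution of terms for individual variables under a binder. -/
def liftTm (σ : ℕ → L.Term ℕ) : ℕ → L.Term ℕ
  | 0 => FirstOrder.Language.Term.var 0
  | k + 1 => (σ k).relabel Nat.succ

/-- The substitution of the term `a` for the individual variable `0`, the other individual
variables being lowered by one. -/
def singleTm (a : L.Term ℕ) : ℕ → L.Term ℕ
  | 0 => a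
  | k + 1 => FirstOrder.Language.Term.var k

/-- The substitution raising all individual variables by one. -/
def shiftTm : ℕ → L.Term ℕ := fun k => FirstOrder.Language.Term.var (k + 1)

/-- The head `H` with its relation variable raised by one. -/
def Head.succ {n : ℕ} : Head L n → Head L n
  | .var k => .var (k + 1)
  | .sym P => .sym P

/-- The effect on a head of a substitution of heads for relation variables. -/
def Head.subst (τ : ∀ n, ℕ → Head L n) {n : ℕ} : Head L n → Head L n
  | .var k => τ n k
  | .sym P => .sym P

/-- Extension of a substitution of heads for relation variables under a binder of a relation
variable of arity `m`: only the variables of arity `m` are concerned. -/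
def liftHd (m : ℕ) (τ : ∀ n, ℕ → Head L n) : ∀ n, ℕ → Head L n := fun n k =>
  if n = m then
    match k with
    | 0 => .var 0
    | k + 1 => (τ n k).succ
  else τ n k

/-- The substitution of the relation variable or symbol `Y` of arity `m` for the relation
variable `0` of arity `m`, the other relation variables of arity `m` being lowered by one. -/
def singleHd (m : ℕ) (Y : Head L m) : ∀ n, ℕ → Head L n := fun n k =>
  if h : n = m then
    match k with
    | 0 => h.symm ▸ Y
    | k + 1 => .var k
  else .var k

/-- The substitution raising all relation variables of arity `m` by one. -/
def shiftHd (m : ℕ) : ∀ n, ℕ → Head L n := fun n k =>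
  if n = m then .var (k + 1) else .var k

namespace Formula

/-- Simultaneous capture-avoiding substitution of terms for individual variables. -/
def substTm : (ℕ → L.Term ℕ) → Formula L → Formula L
  | σ, atom H ts => atom H (fun i => (ts i).subst σ)
  | σ, imp A B => imp (substTm σ A) (substTm σ B)
  | σ, allInd A => allInd (substTm (liftTm σ) A)
  | σ, allRel n A => allRel n (substTm σ A)

/-- Simultaneous capture-avoiding substitution of relation variables or symbols for relation
variables. -/
def substHd : (∀ n, ℕ → Head L n) → Formula L → Formula L
  | τ, atom H ts => atom (H.subst τ) ts
  | τ, imp A B => imp (substHd τ A) (substHd τ B)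
  | τ, allInd A => allInd (substHd τ A)
  | τ, allRel n A => allRel n (substHd (liftHd n τ) A)

/-- The individual variable `x` is free in the formula. -/
def FreeInd : Formula L → ℕ → Prop
  | atom _ ts, x => ∃ i, x ∈ (ts i).varFinset
  | imp A B, x => A.FreeInd x ∨ B.FreeInd x
  | allInd A, x => A.FreeInd (x + 1)
  | allRel _ A, x => A.FreeInd x

/-- The relation variable `X` of arity `m` is free in the formula. -/
def FreeRel (m : ℕ) : Formula L → ℕ → Prop
  | atom (n := n) (.var k) _, X => n = m ∧ k = X
  | atom (.sym _) _, _ => False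
  | imp A B, X => A.FreeRel m X ∨ B.FreeRel m X
  | allInd A, X => A.FreeRel m X
  | allRel n A, X => if n = m then A.FreeRel m (X + 1) else A.FreeRel m X

/-- A formula is closed if it has no free variable of either kind. -/
def Closed (A : Formula L) : Prop :=
  (∀ x, ¬ A.FreeInd x) ∧ ∀ m X, ¬ A.FreeRel m X

/-- `A.Forall2 true`: the second-order quantifiers of `A` are positive (`∀₂⁺`).
`A.Forall2 false`: the second-order quantifiers of `A` are negative (`∀₂⁻`), where a quantifier
over a relation variable that does not occur in its scope is also admitted. -/
def Forall2 : Formula L → Bool → Prop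
  | atom _ _, _ => True
  | imp B A, s => B.Forall2 (!s) ∧ A.Forall2 s
  | allInd A, s => A.Forall2 s
  | allRel _ A, true => A.Forall2 true
  | allRel n A, false => A.Forall2 false ∧ ¬ A.FreeRel n 0

end Formula

/-! ### The typing system `AF2₀` -/

/-- `a = b` is a particular case of an equation of `E`: an instance of one of the equations
of `E`, read in either direction. -/
def ParticularCase (E : Set (L.Term ℕ × L.Term ℕ)) (a b : L.Term ℕ) : Prop :=
  ∃ e ∈ E, ∃ σ : ℕ → L.Term ℕ,
    (a = e.1.subst σ ∧ b = e.2.subst σ) ∨ (a = e.2.subst σ ∧ b = e.1.subst σ)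

/-- `Typed E Γ t A`: the term `t` has type `A` in the context `Γ` in the system `AF2₀` with the
equations `E`. The context `Γ = [A₀, A₁, …]` declares the variable `i` to be of type `Aᵢ`.
That the quantified variable is not free in the context is expressed by raising the variables
of `Γ`. -/
inductive Typed (E : Set (L.Term ℕ × L.Term ℕ)) : List (Formula L) → Lam → Formula L → Prop
  | var {Γ : List (Formula L)} {i : ℕ} {A : Formula L} :
      Γ[i]? = some A → Typed E Γ (.var i) A
  | lam {Γ : List (Formula L)} {t : Lam} {A B : Formula L} :
      Typed E (A :: Γ) t B → Typed E Γ (.lam t) (.imp A B)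
  | app {Γ : List (Formula L)} {t s : Lam} {A B : Formula L} :
      Typed E Γ t (.imp A B) → Typed E Γ s A → Typed E Γ (.app t s) B
  | introInd {Γ : List (Formula L)} {t : Lam} {A : Formula L} :
      Typed E (Γ.map (Formula.substTm shiftTm)) t A → Typed E Γ t (.allInd A)
  | elimInd {Γ : List (Formula L)} {t : Lam} {A : Formula L} (a : L.Term ℕ) :
      Typed E Γ t (.allInd A) → Typed E Γ t (A.substTm (singleTm a))
  | introRel {Γ : List (Formula L)} {t : Lam} {n : ℕ} {A : Formula L} :
      Typed E (Γ.map (Formula.substHd (shiftHd n))) t A → Typed E Γ t (.allRel n A)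
  | elimRel {Γ : List (Formula L)} {t : Lam} {n : ℕ} {A : Formula L} (Y : Head L n) :
      Typed E Γ t (.allRel n A) → Typed E Γ t (A.substHd (singleHd n Y))
  | eqn {Γ : List (Formula L)} {t : Lam} {A : Formula L} {a b : L.Term ℕ} :
      ParticularCase E a b →
      Typed E Γ t (A.substTm (singleTm a)) → Typed E Γ t (A.substTm (singleTm b))

/-! ### Models whose truth values are sets of lambda-terms -/

/-- A set of lambda-terms is saturated if it is stable under beta-eta-equivalence. -/
def Saturated (G : Set Lam) : Prop :=
  ∀ t s, s ∈ G → Lam.BetaEtaEq t s → t ∈ G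

/-- The set of the terms `t` such that `(t)s ∈ G'` for all `s ∈ G`. -/
def arrow (G G' : Set Lam) : Set Lam := {t | ∀ s ∈ G, Lam.app t s ∈ G'}

/-- A set of saturated sets of lambda-terms is adequate if it is stable under `arrow` and under
arbitrary intersections (the empty one, which is the set of all terms, included). -/
structure Adequate (R : Set (Set Lam)) : Prop where
  saturated : ∀ G ∈ R, Saturated G
  arrow_mem : ∀ G ∈ R, ∀ G' ∈ R, arrow G G' ∈ R
  sInter_mem : ∀ S ⊆ R, ⋂₀ S ∈ R

/-- A model of the language with truth values in an adequate set of saturated sets of terms. -/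
structure Model (L : FirstOrder.Language.{u, v}) : Type (max u v (w + 1)) where
  Carrier : Type w
  nonempty : Nonempty Carrier
  R : Set (Set Lam)
  adequate : Adequate R
  funMap : ∀ {n : ℕ}, L.Functions n → (Fin n → Carrier) → Carrier
  relMap : ∀ {n : ℕ}, L.Relations n → (Fin n → Carrier) → R

namespace Model

variable (M : Model.{u, v, w} L)

/-- An interpretation of the individual variables and of the relation variables. -/
structure Interp where
  ind : ℕ → M.Carrier
  rel : ∀ n : ℕ, ℕ → (Fin n → M.Carrier) → M.R

variable {M}

/-- The interpretation under a binder of an individual variable, whose value is `a`. -/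
def Interp.pushInd (I : M.Interp) (a : M.Carrier) : M.Interp where
  ind := fun k => match k with
    | 0 => a
    | k + 1 => I.ind k
  rel := I.rel

/-- The interpretation under a binder of a relation variable of arity `m`, whose value is `Φ`. -/
def Interp.pushRel (I : M.Interp) (m : ℕ) (Φ : (Fin m → M.Carrier) → M.R) : M.Interp where
  ind := I.ind
  rel := fun n k =>
    if h : n = m then
      match k with
      | 0 => h.symm ▸ Φ
      | k + 1 => I.rel n k
    else I.rel n k

variable (M)

/-- The value of an individual term. -/
def termVal (ι : ℕ → M.Carrier) : L.Term ℕ → M.Carrier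
  | .var x => ι x
  | .func f ts => M.funMap f (fun i => termVal ι (ts i))

variable {M}

/-- The truth function denoted by a relation variable or symbol. -/
def headVal (I : M.Interp) {n : ℕ} : Head L n → (Fin n → M.Carrier) → M.R
  | .var X => I.rel n X
  | .sym P => M.relMap P

/-- The value of a formula. -/
def val : Formula L → M.Interp → Set Lam
  | .atom H ts, I => headVal I H (fun i => M.termVal I.ind (ts i))
  | .imp A B, I => arrow (val A I) (val B I)
  | .allInd A, I => ⋂ a : M.Carrier, val A (I.pushInd a)
  | .allRel n A, I => ⋂ Φ : (Fin n → M.Carrier) → M.R, val A (I.pushRel n Φ)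

variable (M)

/-- The model satisfies all the equations of `E`, universally closed. -/
def Satisfies (E : Set (L.Term ℕ × L.Term ℕ)) : Prop :=
  ∀ e ∈ E, ∀ ι : ℕ → M.Carrier, M.termVal ι e.1 = M.termVal ι e.2

end Model

/-- For a closed formula `A`, the set `|A|_{βη}`: the intersection of the values of `A` in all the
models of `E`. The value of a closed formula does not depend on the interpretation. -/
def interpretation (E : Set (L.Term ℕ × L.Term ℕ)) (A : Formula L) : Set Lam :=
  {t | ∀ M : Model.{u, v, w} L, M.Satisfies E → ∀ I : M.Interp, t ∈ Model.val A I}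

end AF2

/-! Soundness is the realizability induction on derivations (`Typed.subst_mem_val`): saturation
absorbs the beta-step created by an abstraction, and satisfaction of `E` accounts for the equational
rule.

For completeness, `t` is tested in a single model built from typing itself. Fix a sequence `G` of
declarations in which every formula recurs infinitely often. Individuals are first-order terms
modulo indiscernibility by the typing system, which forces the equations of `E`. An atom denotes the
set of λ-terms equivalent to a beta-normal term of that type. By induction on formulas
(`val_termModel`), a `∀₂⁺` formula denotes at most its normal inhabitants, and a `∀₂⁻` formula at
least its neutral ones, that is, those with a normal representative that is not an abstraction. Rule
(7₀) suffices because a positive second-order quantifier only has to be instantiated at relation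
variables, while a negative one is vacuous. An arrow is treated by applying to a fresh declared
variable and then abstracting it, which gives back the term up to eta.

Normal representatives are needed to control contexts. By confluence, a normal term has the fewest
free variables in its class (`Normal.free_of_eq`), so the part of `G` that types it is bounded in
terms of the given λ-term alone, and fresh quantified variables can be chosen in advance. Moreover
only variables above those of `t` are used, so the representative obtained for `t` itself is closed.

The sequence `G` requires countably many formulas. In general, only the countably many symbols of
`A` and `E` matter: models over these symbols expand to models over `L`, and derivations over them
are derivations over `L`. -/

namespace AF2

/-! ### Renaming, substitution and free variables of λ-terms -/

namespace Lam

/-- The variable `i` is free in the term. -/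
def Free : Lam → ℕ → Prop
  | var k, i => k = i
  | app t s, i => Free t i ∨ Free s i
  | lam t, i => Free t (i + 1)

theorem exists_free_lt (t : Lam) : ∃ N, ∀ i, Free t i → i < N := by
  induction t with
  | var k => exact ⟨k + 1, fun i h => by simp only [Free] at h; omega⟩
  | app t s iht ihs =>
    obtain ⟨N, hN⟩ := iht
    obtain ⟨K, hK⟩ := ihs
    exact ⟨max N K, fun i h => h.elim (fun h => lt_max_of_lt_left (hN i h))
      (fun h => lt_max_of_lt_right (hK i h))⟩
  | lam t ih =>
    obtain ⟨N, hN⟩ := ih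
    exact ⟨N, fun i h => by have := hN _ h; omega⟩

theorem rename_congr {t : Lam} {ρ ρ' : ℕ → ℕ} (h : ∀ i, Free t i → ρ i = ρ' i) :
    rename ρ t = rename ρ' t := by
  induction t generalizing ρ ρ' with
  | var k => simp only [rename, h k rfl]
  | app t s iht ihs =>
    simp only [rename]
    rw [iht fun i hi => h i (.inl hi), ihs fun i hi => h i (.inr hi)]
  | lam t ih =>
    simp only [rename]
    rw [ih]
    rintro (_ | k) hk
    · rfl
    · simp only [liftRen, h k hk]

theorem liftRen_id : liftRen id = id := by
  funext k; cases k <;> rfl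

theorem rename_id (t : Lam) : rename id t = t := by
  induction t with
  | var k => rfl
  | app t s iht ihs => simp only [rename, iht, ihs]
  | lam t ih => simp only [rename, liftRen_id, ih]

theorem rename_rename (ρ ρ' : ℕ → ℕ) (t : Lam) :
    rename ρ' (rename ρ t) = rename (fun k => ρ' (ρ k)) t := by
  induction t generalizing ρ ρ' with
  | var k => rfl
  | app t s iht ihs => simp only [rename, iht, ihs]
  | lam t ih =>
    simp only [rename, ih]
    congr 2
    funext k; cases k <;> rfl

theorem subst_rename (ρ : ℕ → ℕ) (σ : ℕ → Lam) (t : Lam) :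
    subst σ (rename ρ t) = subst (fun k => σ (ρ k)) t := by
  induction t generalizing ρ σ with
  | var k => rfl
  | app t s iht ihs => simp only [rename, subst, iht, ihs]
  | lam t ih =>
    simp only [rename, subst, ih]
    congr 2
    funext k; cases k <;> rfl

theorem rename_subst (ρ : ℕ → ℕ) (σ : ℕ → Lam) (t : Lam) :
    rename ρ (subst σ t) = subst (fun k => rename ρ (σ k)) t := by
  induction t generalizing ρ σ with
  | var k => rfl
  | app t s iht ihs => simp only [rename, subst, iht, ihs]
  | lam t ih =>
    simp only [rename, subst, ih]
    congr 2
    funext k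
    cases k with
    | zero => rfl
    | succ k => simp only [liftSub, rename_rename]; rfl

theorem subst_subst (σ τ : ℕ → Lam) (t : Lam) :
    subst τ (subst σ t) = subst (fun k => subst τ (σ k)) t := by
  induction t generalizing σ τ with
  | var k => rfl
  | app t s iht ihs => simp only [subst, iht, ihs]
  | lam t ih =>
    simp only [subst, ih]
    congr 2
    funext k
    cases k with
    | zero => rfl
    | succ k => simp only [liftSub, subst_rename, rename_subst]

theorem liftSub_var : liftSub var = var := by
  funext k; cases k <;> rfl

theorem subst_var (t : Lam) : subst var t = t := by
  induction t with
  | var k => rfl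
  | app t s iht ihs => simp only [subst, iht, ihs]
  | lam t ih => simp only [subst, liftSub_var, ih]

theorem subst_single_rename_succ (s t : Lam) : subst (single s) (rename Nat.succ t) = t := by
  rw [subst_rename]
  exact subst_var t

theorem subst_subst_single (σ : ℕ → Lam) (t s : Lam) :
    subst σ (subst (single s) t) = subst (single (subst σ s)) (subst (liftSub σ) t) := by
  rw [subst_subst, subst_subst]
  congr 1
  funext k
  cases k with
  | zero => rfl
  | succ k => exact (subst_single_rename_succ _ _).symm

theorem rename_subst_single (ρ : ℕ → ℕ) (t s : Lam) :
    rename ρ (subst (single s) t) = subst (single (rename ρ s)) (rename (liftRen ρ) t) := by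
  rw [rename_subst, subst_rename]
  congr 1
  funext k
  cases k <;> rfl

theorem rename_liftRen_rename_succ (ρ : ℕ → ℕ) (t : Lam) :
    rename (liftRen ρ) (rename Nat.succ t) = rename Nat.succ (rename ρ t) := by
  rw [rename_rename, rename_rename]; rfl

theorem subst_liftSub_rename_succ (σ : ℕ → Lam) (t : Lam) :
    subst (liftSub σ) (rename Nat.succ t) = rename Nat.succ (subst σ t) := by
  rw [subst_rename, rename_subst]; rfl

theorem rename_pred_rename_succ (t : Lam) : rename Nat.pred (rename Nat.succ t) = t := by
  rw [rename_rename]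
  exact rename_id t

theorem rename_succ_injective : Function.Injective (rename Nat.succ) :=
  Function.LeftInverse.injective rename_pred_rename_succ

theorem free_rename {t : Lam} {ρ : ℕ → ℕ} {i : ℕ} :
    Free (rename ρ t) i ↔ ∃ k, Free t k ∧ ρ k = i := by
  induction t generalizing ρ i with
  | var k => simp [rename, Free]
  | app t s iht ihs =>
    simp only [rename, Free, iht, ihs, or_and_right, exists_or]
  | lam t ih =>
    simp only [rename, Free, ih]
    constructor
    · rintro ⟨_ | k, hk, h⟩
      · simp [liftRen] at h
      · exact ⟨k, hk, by simpa [liftRen] using h⟩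
    · rintro ⟨k, hk, h⟩
      exact ⟨k + 1, hk, by simpa [liftRen] using h⟩

theorem free_subst {t : Lam} {σ : ℕ → Lam} {i : ℕ} :
    Free (subst σ t) i ↔ ∃ k, Free t k ∧ Free (σ k) i := by
  induction t generalizing σ i with
  | var k => simp [subst, Free]
  | app t s iht ihs =>
    simp only [subst, Free, iht, ihs, or_and_right, exists_or]
  | lam t ih =>
    simp only [subst, Free, ih]
    constructor
    · rintro ⟨_ | k, hk, h⟩
      · simp [liftSub, Free] at h
      · rw [liftSub, free_rename] at h
        obtain ⟨j, hj, e⟩ := h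
        cases e
        exact ⟨k, hk, hj⟩
    · rintro ⟨k, hk, h⟩
      exact ⟨k + 1, hk, free_rename.2 ⟨i, h, rfl⟩⟩

theorem exists_eq_rename_succ {t : Lam} (h : ¬ Free t 0) : ∃ s, t = rename Nat.succ s := by
  refine ⟨rename Nat.pred t, ?_⟩
  rw [rename_rename]
  conv_lhs => rw [← rename_id t]
  apply rename_congr
  rintro (_ | k) hk
  · exact absurd hk h
  · rfl

/-- A lifted renaming sends 0 to 0, so if 0 is missing from the image it is missing from the source.
This recovers an eta-redex from its renamed copy. -/
theorem rename_liftRen_eq_rename_succ {ρ : ℕ → ℕ} {t s : Lam}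
    (h : rename (liftRen ρ) t = rename Nat.succ s) :
    ∃ r, t = rename Nat.succ r ∧ s = rename ρ r := by
  have h0 : ¬ Free t 0 := fun h0 => by
    have : Free (rename (liftRen ρ) t) 0 := free_rename.2 ⟨0, h0, rfl⟩
    rw [h, free_rename] at this
    obtain ⟨k, -, hk⟩ := this
    exact Nat.succ_ne_zero k hk
  obtain ⟨r, rfl⟩ := exists_eq_rename_succ h0
  rw [rename_liftRen_rename_succ] at h
  exact ⟨r, rfl, (rename_succ_injective h).symm⟩

/-! ### Confluence -/

/-- Parallel beta-eta-reduction. -/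
inductive Par : Lam → Lam → Prop
  | var (k : ℕ) : Par (var k) (var k)
  | app {t t' s s' : Lam} : Par t t' → Par s s' → Par (app t s) (app t' s')
  | lam {t t' : Lam} : Par t t' → Par (lam t) (lam t')
  | beta {t t' s s' : Lam} : Par t t' → Par s s' → Par (app (lam t) s) (subst (single s') t')
  | eta {t t' : Lam} : Par t t' → Par (Lam.lam (app (rename Nat.succ t) (var 0))) t'

theorem Par.refl (t : Lam) : Par t t := by
  induction t with
  | var k => exact .var k
  | app t s iht ihs => exact .app iht ihs
  | lam t ih => exact .lam ih

theorem Step.par {t s : Lam} (h : Step t s) : Par t s := by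
  induction h with
  | beta t s => exact .beta (.refl t) (.refl s)
  | eta t => exact .eta (.refl t)
  | appL s _ ih => exact .app ih (.refl s)
  | appR t _ ih => exact .app (.refl t) ih
  | lam _ ih => exact .lam ih

theorem Par.rename {t t' : Lam} (h : Par t t') (ρ : ℕ → ℕ) :
    Par (Lam.rename ρ t) (Lam.rename ρ t') := by
  induction h generalizing ρ with
  | var k => exact .var _
  | app _ _ iht ihs => exact .app (iht ρ) (ihs ρ)
  | lam _ ih => exact .lam (ih _)
  | beta _ _ iht ihs =>
    rw [rename_subst_single]
    exact .beta (iht _) (ihs ρ)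
  | eta _ ih =>
    simp only [Lam.rename, rename_liftRen_rename_succ]
    exact .eta (ih ρ)

theorem Par.subst {t t' : Lam} (h : Par t t') {σ σ' : ℕ → Lam} (hσ : ∀ k, Par (σ k) (σ' k)) :
    Par (Lam.subst σ t) (Lam.subst σ' t') := by
  have lift : ∀ {σ σ' : ℕ → Lam}, (∀ k, Par (σ k) (σ' k)) →
      ∀ k, Par (liftSub σ k) (liftSub σ' k) := by
    rintro σ σ' hσ (_ | k)
    · exact .var 0
    · exact (hσ k).rename _
  induction h generalizing σ σ' with
  | var k => exact hσ k
  | app _ _ iht ihs => exact .app (iht hσ) (ihs hσ)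
  | lam _ ih => exact .lam (ih (lift hσ))
  | beta _ _ iht ihs =>
    rw [subst_subst_single]
    exact .beta (iht (lift hσ)) (ihs hσ)
  | eta _ ih =>
    simp only [Lam.subst, subst_liftSub_rename_succ]
    exact .eta (ih hσ)

theorem Par.subst_single {t t' s s' : Lam} (h : Par t t') (hs : Par s s') :
    Par (Lam.subst (single s) t) (Lam.subst (single s') t') := by
  refine h.subst ?_
  rintro (_ | k)
  · exact hs
  · exact .var k

/-- Injectivity of `ρ` plays no role: a renaming replaces variables by variables, so it creates no
beta-redex, and a lifted renaming sends only 0 to 0 and preserves the other occurrences as nonzero,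
so it creates no eta-redex. -/
theorem Par.of_rename {ρ : ℕ → ℕ} {t u : Lam} (h : Par (Lam.rename ρ t) u) :
    ∃ u', Par t u' ∧ u = Lam.rename ρ u' := by
  generalize hr : Lam.rename ρ t = r at h
  induction h generalizing ρ t with
  | var k =>
    cases t <;> simp only [Lam.rename, Lam.var.injEq, reduceCtorEq] at hr
    exact ⟨_, .var _, by rw [Lam.rename, hr]⟩
  | app _ _ iht ihs =>
    cases t <;> simp only [Lam.rename, Lam.app.injEq, reduceCtorEq] at hr
    obtain ⟨a, ha, rfl⟩ := iht hr.1
    obtain ⟨b, hb, rfl⟩ := ihs hr.2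
    exact ⟨_, .app ha hb, rfl⟩
  | lam _ ih =>
    cases t <;> simp only [Lam.rename, Lam.lam.injEq, reduceCtorEq] at hr
    obtain ⟨a, ha, rfl⟩ := ih hr
    exact ⟨_, .lam ha, rfl⟩
  | beta _ _ iht ihs =>
    cases t <;> simp only [Lam.rename, Lam.app.injEq, reduceCtorEq] at hr
    rename_i f s
    cases f <;> simp only [Lam.rename, Lam.lam.injEq, reduceCtorEq, false_and] at hr
    obtain ⟨a, ha, rfl⟩ := iht hr.1
    obtain ⟨b, hb, rfl⟩ := ihs hr.2
    exact ⟨_, .beta ha hb, (rename_subst_single _ _ _).symm⟩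
  | eta _ ih =>
    cases t <;> simp only [Lam.rename, Lam.lam.injEq, reduceCtorEq] at hr
    rename_i f
    cases f <;> simp only [Lam.rename, Lam.app.injEq, reduceCtorEq] at hr
    rename_i f x
    obtain ⟨r, rfl, hr'⟩ := rename_liftRen_eq_rename_succ hr.1
    obtain ⟨a, ha, rfl⟩ := ih hr'.symm
    cases x <;> simp only [Lam.rename, Lam.var.injEq, reduceCtorEq, and_false] at hr
    rename_i k
    cases k with
    | zero => exact ⟨_, .eta ha, rfl⟩
    | succ k => simp [liftRen] at hr

theorem subst_single_rename_liftRen_succ (t : Lam) :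
    subst (single (var 0)) (rename (liftRen Nat.succ) t) = t := by
  rw [subst_rename]
  conv_rhs => rw [← subst_var t]
  congr 1
  funext k
  cases k <;> rfl

/-- This is the overlap of eta with beta. The body of an eta-redex either reduces inside `r`, and
stays the body of an eta-redex, or is itself a beta-redex because `r` is an abstraction; contracting
it then merely undoes the shift. -/
theorem Par.of_app_rename_succ {r t : Lam} (h : Par (Lam.app (Lam.rename Nat.succ r) (Lam.var 0)) t) :
    (∃ r', Par r r' ∧ t = Lam.app (Lam.rename Nat.succ r') (Lam.var 0)) ∨
      ∃ r₀, r = Lam.lam r₀ ∧ Par r₀ t := by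
  generalize hq : Lam.rename Nat.succ r = q at h
  cases h with
  | app h hs =>
    subst hq
    obtain ⟨r', hr, rfl⟩ := h.of_rename
    cases hs
    exact .inl ⟨r', hr, rfl⟩
  | beta h hs =>
    cases hs
    cases r <;> simp only [Lam.rename, Lam.lam.injEq, reduceCtorEq] at hq
    subst hq
    obtain ⟨r', hr, rfl⟩ := h.of_rename
    rw [subst_single_rename_liftRen_succ]
    exact .inr ⟨_, rfl, hr⟩

/-- The number of constructors of a term. -/
def size : Lam → ℕ
  | var _ => 1
  | app t s => size t + size s + 1
  | lam t => size t + 1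

theorem size_rename (ρ : ℕ → ℕ) (t : Lam) : size (rename ρ t) = size t := by
  induction t generalizing ρ with
  | var k => rfl
  | app t s iht ihs => simp only [rename, size, iht, ihs]
  | lam t ih => simp only [rename, size, ih]

/-- Two overlaps go beyond pure beta: a beta-redex whose function is an eta-redex (`app_beta`), and
an eta-redex whose body is a beta-redex (`lam_eta`). They call the induction hypothesis on terms
that are not subterms, such as `r` in place of its shifted copy. Renaming preserves size, hence the
induction on size. -/
theorem Par.diamond {t a b : Lam} (ha : Par t a) (hb : Par t b) : ∃ c, Par a c ∧ Par b c := by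
  induction hn : size t using Nat.strong_induction_on generalizing t a b with
  | _ n ih =>
  subst hn
  have app_beta : ∀ {t s f₁ s₁ t₂ s₂ : Lam}, (∀ {t' a b : Lam}, size t' < size (Lam.app (.lam t) s) →
      Par t' a → Par t' b → ∃ c, Par a c ∧ Par b c) → Par (.lam t) f₁ → Par s s₁ → Par t t₂ →
      Par s s₂ → ∃ c, Par (.app f₁ s₁) c ∧ Par (Lam.subst (single s₂) t₂) c := by
    intro t s f₁ s₁ t₂ s₂ ih hf hs₁ ht₂ hs₂
    obtain ⟨s₃, hs₁₃, hs₂₃⟩ := ih (by simp only [size]; omega) hs₁ hs₂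
    cases hf with
    | lam ht₁ =>
      obtain ⟨t₃, ht₁₃, ht₂₃⟩ := ih (by simp only [size]; omega) ht₁ ht₂
      exact ⟨_, .beta ht₁₃ hs₁₃, ht₂₃.subst_single hs₂₃⟩
    | eta hr₁ =>
      rename_i r
      rcases ht₂.of_app_rename_succ with ⟨r₂, hr₂, rfl⟩ | ⟨r₀, rfl, hr₂⟩
      · obtain ⟨r₃, hr₁₃, hr₂₃⟩ := ih (by simp only [size, size_rename]; omega) hr₁ hr₂
        refine ⟨_, .app hr₁₃ hs₁₃, ?_⟩
        simp only [Lam.subst, subst_single_rename_succ]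
        exact .app hr₂₃ hs₂₃
      -- Both sides are parallel reducts of `(λ r₀) s`, one by application and the other by beta,
      -- and this term is smaller than the original one.
      · exact ih (t' := .app (.lam r₀) s) (by simp only [size, size_rename]; omega)
          (.app hr₁ hs₁) (.beta hr₂ hs₂)
  have lam_eta : ∀ {r t₁ r₂ : Lam},
      (∀ {t' a b : Lam}, size t' < size (.lam (.app (Lam.rename Nat.succ r) (.var 0))) →
      Par t' a → Par t' b → ∃ c, Par a c ∧ Par b c) →
      Par (.app (Lam.rename Nat.succ r) (.var 0)) t₁ → Par r r₂ →
      ∃ c, Par (.lam t₁) c ∧ Par r₂ c := by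
    intro r t₁ r₂ ih ht hr₂
    rcases ht.of_app_rename_succ with ⟨r₁, hr₁, rfl⟩ | ⟨r₀, rfl, hr₁⟩
    · obtain ⟨r₃, hr₁₃, hr₂₃⟩ := ih (by simp only [size, size_rename]; omega) hr₁ hr₂
      exact ⟨r₃, .eta hr₁₃, hr₂₃⟩
    · exact ih (by simp only [size, size_rename]; omega) (.lam hr₁) hr₂
  have ih' : ∀ {t' a b : Lam}, size t' < size t → Par t' a → Par t' b →
    ∃ c, Par a c ∧ Par b c := fun h ha hb => ih _ h ha hb rfl
  clear ih
  cases ha with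
  | var k => exact ⟨b, hb, .refl b⟩
  | app ht₁ hs₁ =>
    generalize hq : Lam.app _ _ = q at hb ih'
    cases hb with
    | app ht₂ hs₂ =>
      cases hq
      obtain ⟨c, hc⟩ := ih' (by simp only [size]; omega) ht₁ ht₂
      obtain ⟨d, hd⟩ := ih' (by simp only [size]; omega) hs₁ hs₂
      exact ⟨_, .app hc.1 hd.1, .app hc.2 hd.2⟩
    | beta ht₂ hs₂ =>
      cases hq
      exact app_beta ih' ht₁ hs₁ ht₂ hs₂
    | _ => cases hq
  | lam ht₁ =>
    generalize hq : Lam.lam _ = q at hb ih'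
    cases hb with
    | lam ht₂ =>
      cases hq
      obtain ⟨c, hc⟩ := ih' (by simp only [size]; omega) ht₁ ht₂
      exact ⟨_, .lam hc.1, .lam hc.2⟩
    | eta hr₂ =>
      cases hq
      exact lam_eta ih' ht₁ hr₂
    | _ => cases hq
  | beta ht₁ hs₁ =>
    generalize hq : Lam.app _ _ = q at hb ih'
    cases hb with
    | app ht₂ hs₂ =>
      cases hq
      exact (app_beta ih' ht₂ hs₂ ht₁ hs₁).imp fun _ h => h.symm
    | beta ht₂ hs₂ =>
      cases hq
      obtain ⟨c, hc⟩ := ih' (by simp only [size]; omega) ht₁ ht₂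
      obtain ⟨d, hd⟩ := ih' (by simp only [size]; omega) hs₁ hs₂
      exact ⟨_, hc.1.subst_single hd.1, hc.2.subst_single hd.2⟩
    | _ => cases hq
  | eta hr₁ =>
    generalize hq : Lam.lam _ = q at hb ih'
    cases hb with
    | lam ht₂ =>
      cases hq
      exact (lam_eta ih' ht₂ hr₁).imp fun _ h => h.symm
    | eta hr₂ =>
      rw [Lam.lam.injEq, Lam.app.injEq] at hq
      cases rename_succ_injective hq.1
      exact ih' (by simp only [size, size_rename]; omega) hr₁ hr₂
    | _ => cases hq

open Relation in
theorem Par.steps {t s : Lam} (h : Par t s) : ReflTransGen Step t s := by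
  have happ : ∀ {t t' s s' : Lam}, ReflTransGen Step t t' → ReflTransGen Step s s' →
      ReflTransGen Step (.app t s) (.app t' s') := fun {_ t' s _} ht hs =>
    (ht.lift (fun x => Lam.app x s) fun _ _ h => Step.appL s h).trans
      (hs.lift (fun x => Lam.app t' x) fun _ _ h => Step.appR t' h)
  induction h with
  | var k => exact .refl
  | app _ _ iht ihs => exact happ iht ihs
  | lam _ ih => exact ih.lift _ fun _ _ h => Step.lam h
  | beta _ _ iht ihs =>
    exact (happ (iht.lift _ fun _ _ h => Step.lam h) ihs).tail (Step.beta _ _)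
  | eta _ ih => exact .head (Step.eta _) ih

open Relation in
/-- The Church-Rosser property of beta-eta-reduction. -/
theorem BetaEtaEq.join {t s : Lam} (h : BetaEtaEq t s) : Join (ReflTransGen Step) t s := by
  -- One step is a parallel step, and a parallel step is a finite sequence of steps. The two
  -- relations thus have the same reflexive-transitive closure, and the diamond property of `Par`
  -- yields confluence.
  have toPar : ∀ {a b}, ReflTransGen Step a b → ReflTransGen Par a b :=
    fun h => h.lift id fun _ _ => Step.par
  have toStep : ∀ {a b}, ReflTransGen Par a b → ReflTransGen Step a b := by
    intro a b h
    induction h with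
    | refl => exact .refl
    | tail _ h ih => exact ih.trans h.steps
  induction h with
  | rel a b h => exact ⟨b, .single h, .refl⟩
  | refl a => exact ⟨a, .refl, .refl⟩
  | symm a b _ ih => exact ih.imp fun _ h => ⟨h.2, h.1⟩
  | trans a b c _ _ ih₁ ih₂ =>
    obtain ⟨x, hax, hbx⟩ := ih₁
    obtain ⟨y, hby, hcy⟩ := ih₂
    obtain ⟨z, hxz, hyz⟩ := church_rosser
      (fun a b c hab hac => (hab.diamond hac).imp fun d hd => ⟨.single hd.1, .single hd.2⟩)
      (toPar hbx) (toPar hby)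
    exact ⟨z, hax.trans (toStep hxz), hcy.trans (toStep hyz)⟩

/-! ### Beta-normal terms -/

/-- The term is an abstraction. -/
def IsAbs : Lam → Prop
  | lam _ => True
  | _ => False

/-- The term is beta-normal. -/
def Normal : Lam → Prop
  | var _ => True
  | app t s => Normal t ∧ ¬ IsAbs t ∧ Normal s
  | lam t => Normal t

theorem isAbs_rename {ρ : ℕ → ℕ} {t : Lam} : IsAbs (rename ρ t) ↔ IsAbs t := by
  cases t <;> rfl

theorem normal_rename {ρ : ℕ → ℕ} {t : Lam} : Normal (rename ρ t) ↔ Normal t := by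
  induction t generalizing ρ with
  | var k => rfl
  | app t s iht ihs => simp only [rename, Normal, iht, ihs, isAbs_rename]
  | lam t ih => simp only [rename, Normal, ih]

theorem Step.free {t s : Lam} (h : Step t s) {i : ℕ} (hi : Free s i) : Free t i := by
  induction h generalizing i with
  | beta t s =>
    obtain ⟨_ | k, hk, h⟩ := free_subst.1 hi
    · exact .inr h
    · cases h
      exact .inl hk
  | eta t => exact .inl (free_rename.2 ⟨i, hi, rfl⟩)
  | appL s _ ih => exact hi.imp ih id
  | appR t _ ih => exact hi.imp id ih
  | lam _ ih => exact ih hi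

/-- Only eta-steps apply to a beta-normal term, and eta erases no free variable. The clause on
abstractions carries the induction: reducing the function part of an application must not create a
beta-redex. -/
theorem Step.normal {t s : Lam} (h : Step t s) (ht : Normal t) :
    Normal s ∧ (IsAbs s → IsAbs t) ∧ ∀ i, Free t i → Free s i := by
  induction h with
  | beta t s => exact absurd trivial ht.2.1
  | eta t =>
    refine ⟨normal_rename.1 ht.1, fun _ => trivial, fun i hi => ?_⟩
    rcases hi with hi | hi
    · obtain ⟨k, hk, e⟩ := free_rename.1 hi
      cases e
      exact hk
    · cases hi
  | appL s _ ih =>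
    obtain ⟨h₁, h₂, h₃⟩ := ih ht.1
    exact ⟨⟨h₁, fun h => ht.2.1 (h₂ h), ht.2.2⟩, id, fun i => Or.imp (h₃ i) id⟩
  | appR t _ ih =>
    obtain ⟨h₁, h₂, h₃⟩ := ih ht.2.2
    exact ⟨⟨ht.1, ht.2.1, h₁⟩, id, fun i => Or.imp id (h₃ i)⟩
  | lam _ ih =>
    obtain ⟨h₁, h₂, h₃⟩ := ih ht
    exact ⟨h₁, id, fun i => h₃ (i + 1)⟩

/-- A beta-normal term has the least set of free variables in its beta-eta-class. -/
theorem Normal.free_of_eq {t s : Lam} (ht : Normal t) (h : BetaEtaEq t s) {i : ℕ}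
    (hi : Free t i) : Free s i := by
  -- From the normal term `t` the common reduct is reached by eta alone and keeps the variable `i`;
  -- reduction from `s` creates no free variable, so `i` was already free in `s`.
  obtain ⟨r, htr, hsr⟩ := h.join
  have hr : Normal r ∧ Free r i := by
    clear hsr h
    induction htr with
    | refl => exact ⟨ht, hi⟩
    | tail _ h ih => exact ⟨(h.normal ih.1).1, (h.normal ih.1).2.2 i ih.2⟩
  clear htr h
  induction hsr using Relation.ReflTransGen.head_induction_on with
  | refl => exact hr.2
  | head h _ ih => exact h.free ih

/-! ### Congruence properties of the equivalence -/

theorem BetaEtaEq.map {f : Lam → Lam} (hf : ∀ {a b}, Step a b → Step (f a) (f b)) {t s : Lam}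
    (h : BetaEtaEq t s) : BetaEtaEq (f t) (f s) := by
  induction h with
  | rel a b h => exact .rel _ _ (hf h)
  | refl a => exact .refl _
  | symm a b _ ih => exact ih.symm
  | trans a b c _ _ ih₁ ih₂ => exact ih₁.trans _ _ _ ih₂

theorem BetaEtaEq.app {t t' s s' : Lam} (ht : BetaEtaEq t t') (hs : BetaEtaEq s s') :
    BetaEtaEq (.app t s) (.app t' s') :=
  .trans _ _ _ (ht.map fun h => Step.appL s h) (hs.map fun h => Step.appR t' h)

theorem BetaEtaEq.lam {t t' : Lam} (ht : BetaEtaEq t t') : BetaEtaEq (.lam t) (.lam t') :=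
  ht.map fun h => Step.lam h

theorem Step.rename {t s : Lam} (h : Step t s) (ρ : ℕ → ℕ) :
    Step (Lam.rename ρ t) (Lam.rename ρ s) := by
  induction h generalizing ρ with
  | beta t s => rw [rename_subst_single]; exact .beta _ _
  | eta t =>
    simp only [Lam.rename, rename_liftRen_rename_succ]
    exact .eta _
  | appL s _ ih => exact .appL _ (ih ρ)
  | appR t _ ih => exact .appR _ (ih ρ)
  | lam _ ih => exact .lam (ih _)

theorem BetaEtaEq.rename {t s : Lam} (h : BetaEtaEq t s) (ρ : ℕ → ℕ) :
    BetaEtaEq (Lam.rename ρ t) (Lam.rename ρ s) :=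
  h.map fun h => h.rename ρ

end Lam
end AF2

namespace AF2
open FirstOrder.Language

variable {L : FirstOrder.Language.{u, v}}

/-! ### Substitutions in terms and formulas -/

theorem term_subst_congr {a : L.Term ℕ} {σ σ' : ℕ → L.Term ℕ}
    (h : ∀ x ∈ a.varFinset, σ x = σ' x) : a.subst σ = a.subst σ' := by
  induction a with
  | var x => exact h x (by simp [Term.varFinset])
  | func f ts ih =>
    simp only [Term.subst]
    congr 1
    funext i
    exact ih i fun x hx => h x (by simp only [Term.varFinset, Finset.mem_biUnion]; exact ⟨i, by simp, hx⟩)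

theorem term_subst_subst (σ τ : ℕ → L.Term ℕ) (a : L.Term ℕ) :
    (a.subst σ).subst τ = a.subst fun k => (σ k).subst τ := by
  induction a with
  | var x => rfl
  | func f ts ih => simp only [Term.subst, ih]

theorem term_subst_var (a : L.Term ℕ) : a.subst Term.var = a := by
  induction a with
  | var x => rfl
  | func f ts ih => simp only [Term.subst, ih]

theorem relabel_succ (a : L.Term ℕ) : a.relabel Nat.succ = a.subst shiftTm := by
  induction a with
  | var x => rfl
  | func f ts ih => simp only [Term.subst, Term.relabel, ih]

theorem liftTm_subst_liftTm (σ τ : ℕ → L.Term ℕ) :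
    (fun k => (liftTm σ k).subst (liftTm τ)) = liftTm fun k => (σ k).subst τ := by
  funext k
  cases k with
  | zero => rfl
  | succ k =>
    simp only [liftTm, relabel_succ, term_subst_subst]
    congr 1
    funext j
    simp only [shiftTm, Term.subst, liftTm, relabel_succ]

theorem liftTm_var : liftTm (Term.var : ℕ → L.Term ℕ) = Term.var := by
  funext k; cases k <;> rfl

theorem Head.subst_subst (τ τ' : ∀ n, ℕ → Head L n) {n : ℕ} (H : Head L n) :
    (H.subst τ).subst τ' = H.subst fun n k => (τ n k).subst τ' := by
  cases H <;> rfl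

theorem Head.subst_var {n : ℕ} (H : Head L n) : H.subst (fun _ => .var) = H := by
  cases H <;> rfl

theorem liftHd_subst_liftHd (m : ℕ) (τ τ' : ∀ n, ℕ → Head L n) :
    (fun n k => (liftHd m τ n k).subst (liftHd m τ')) =
      liftHd m fun n k => (τ n k).subst τ' := by
  funext n k
  by_cases h : n = m
  · subst h
    cases k with
    | zero => simp [liftHd, Head.subst]
    | succ k =>
      simp only [liftHd, if_true]
      cases τ n k <;> simp [Head.succ, Head.subst, liftHd]
  · simp only [liftHd, h, if_false]
    cases τ n k <;> simp [Head.subst, liftHd, h]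

theorem liftHd_var (m : ℕ) : liftHd m (fun _ => .var : ∀ n, ℕ → Head L n) = fun _ => .var := by
  funext n k
  by_cases h : n = m
  · subst h
    cases k <;> simp [liftHd, Head.succ]
  · simp [liftHd, h]

namespace Formula

theorem substTm_congr {A : Formula L} {σ σ' : ℕ → L.Term ℕ}
    (h : ∀ x, A.FreeInd x → σ x = σ' x) : A.substTm σ = A.substTm σ' := by
  induction A generalizing σ σ' with
  | atom H ts =>
    simp only [substTm]
    congr 1
    funext i
    exact term_subst_congr fun x hx => h x ⟨i, hx⟩
  | imp A B ihA ihB =>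
    simp only [substTm]
    rw [ihA fun x hx => h x (.inl hx), ihB fun x hx => h x (.inr hx)]
  | allInd A ih =>
    simp only [substTm]
    rw [ih]
    rintro (_ | x) hx
    · rfl
    · simp only [liftTm, h x hx]
  | allRel n A ih =>
    simp only [substTm]
    rw [ih h]

theorem substTm_substTm (σ τ : ℕ → L.Term ℕ) (A : Formula L) :
    (A.substTm σ).substTm τ = A.substTm fun k => (σ k).subst τ := by
  induction A generalizing σ τ with
  | atom H ts => simp only [substTm, term_subst_subst]
  | imp A B ihA ihB => simp only [substTm, ihA, ihB]
  | allInd A ih => simp only [substTm, ih, liftTm_subst_liftTm]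
  | allRel n A ih => simp only [substTm, ih]

theorem substTm_var (A : Formula L) : A.substTm Term.var = A := by
  induction A with
  | atom H ts => simp only [substTm, term_subst_var]
  | imp A B ihA ihB => simp only [substTm, ihA, ihB]
  | allInd A ih => simp only [substTm, liftTm_var, ih]
  | allRel n A ih => simp only [substTm, ih]

theorem substHd_congr {A : Formula L} {τ τ' : ∀ n, ℕ → Head L n}
    (h : ∀ n X, A.FreeRel n X → τ n X = τ' n X) : A.substHd τ = A.substHd τ' := by
  induction A generalizing τ τ' with
  | atom H ts =>
    cases H with
    | var k => simp only [substHd, Head.subst, h _ k ⟨rfl, rfl⟩]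
    | sym P => rfl
  | imp A B ihA ihB =>
    simp only [substHd]
    rw [ihA fun n x hx => h n x (.inl hx), ihB fun n x hx => h n x (.inr hx)]
  | allInd A ih =>
    simp only [substHd]
    rw [ih h]
  | allRel m A ih =>
    simp only [substHd]
    rw [ih]
    intro n x hx
    by_cases hn : n = m
    · subst hn
      cases x with
      | zero => simp [liftHd]
      | succ x =>
        simp only [liftHd, if_true]
        rw [h n x (by simpa [FreeRel] using hx)]
    · simp only [liftHd, hn, if_false]
      exact h n x (by simpa [FreeRel, Ne.symm hn] using hx)

theorem substHd_substHd (τ τ' : ∀ n, ℕ → Head L n) (A : Formula L) :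
    (A.substHd τ).substHd τ' = A.substHd fun n k => (τ n k).subst τ' := by
  induction A generalizing τ τ' with
  | atom H ts => simp only [substHd, Head.subst_subst]
  | imp A B ihA ihB => simp only [substHd, ihA, ihB]
  | allInd A ih => simp only [substHd, ih]
  | allRel n A ih => simp only [substHd, ih, liftHd_subst_liftHd]

theorem substHd_var (A : Formula L) : A.substHd (fun _ => .var) = A := by
  induction A with
  | atom H ts => simp only [substHd, Head.subst_var]
  | imp A B ihA ihB => simp only [substHd, ihA, ihB]
  | allInd A ih => simp only [substHd, ih]
  | allRel n A ih => simp only [substHd, liftHd_var, ih]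

theorem substHd_substTm (σ : ℕ → L.Term ℕ) (τ : ∀ n, ℕ → Head L n) (A : Formula L) :
    (A.substTm σ).substHd τ = (A.substHd τ).substTm σ := by
  induction A generalizing σ τ with
  | atom H ts => rfl
  | imp A B ihA ihB => simp only [substTm, substHd, ihA, ihB]
  | allInd A ih => simp only [substTm, substHd, ih]
  | allRel n A ih => simp only [substTm, substHd, ih]

theorem exists_freeInd_lt (A : Formula L) : ∃ N, ∀ x, A.FreeInd x → x < N := by
  induction A with
  | atom H ts =>
    refine ⟨(Finset.univ.biUnion fun i => (ts i).varFinset).sup id + 1, ?_⟩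
    rintro x ⟨i, hx⟩
    exact Nat.lt_succ_of_le (Finset.le_sup (f := id)
      (Finset.mem_biUnion.2 ⟨i, Finset.mem_univ i, hx⟩))
  | imp A B ihA ihB =>
    obtain ⟨N, hN⟩ := ihA
    obtain ⟨K, hK⟩ := ihB
    exact ⟨max N K, fun i h => h.elim (fun h => lt_max_of_lt_left (hN i h))
      (fun h => lt_max_of_lt_right (hK i h))⟩
  | allInd A ih =>
    obtain ⟨N, hN⟩ := ih
    exact ⟨N, fun i h => by have := hN _ h; omega⟩
  | allRel n A ih => exact ih

theorem exists_freeRel_lt (m : ℕ) (A : Formula L) : ∃ N, ∀ X, A.FreeRel m X → X < N := by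
  induction A with
  | atom H ts =>
    cases H with
    | var k => exact ⟨k + 1, fun X h => by have := h.2; omega⟩
    | sym P => exact ⟨0, fun X h => h.elim⟩
  | imp A B ihA ihB =>
    obtain ⟨N, hN⟩ := ihA
    obtain ⟨K, hK⟩ := ihB
    exact ⟨max N K, fun i h => h.elim (fun h => lt_max_of_lt_left (hN i h))
      (fun h => lt_max_of_lt_right (hK i h))⟩
  | allInd A ih => exact ih
  | allRel n A ih =>
    obtain ⟨N, hN⟩ := ih
    refine ⟨N, fun X h => ?_⟩
    by_cases hn : n = m
    · have := hN (X + 1) (by simpa [FreeRel, hn] using h)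
      omega
    · exact hN X (by simpa [FreeRel, hn] using h)

/-- Finitely many formulas miss some individual variable. -/
theorem exists_fresh_ind (Γ : List (Formula L)) : ∃ y, ∀ B ∈ Γ, ¬ B.FreeInd y := by
  suffices h : ∃ N, ∀ B ∈ Γ, ∀ x, B.FreeInd x → x < N by
    obtain ⟨N, hN⟩ := h
    exact ⟨N, fun B hB h => lt_irrefl _ (hN B hB N h)⟩
  induction Γ with
  | nil => exact ⟨0, by simp⟩
  | cons A Γ ih =>
    obtain ⟨N, hN⟩ := ih
    obtain ⟨K, hK⟩ := A.exists_freeInd_lt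
    refine ⟨max N K, List.forall_mem_cons.2 ⟨fun x h => lt_max_of_lt_right (hK x h),
      fun B hB x h => lt_max_of_lt_left (hN B hB x h)⟩⟩

/-- Finitely many formulas miss some relation variable of arity `m`. -/
theorem exists_fresh_rel (m : ℕ) (Γ : List (Formula L)) : ∃ Y, ∀ B ∈ Γ, ¬ B.FreeRel m Y := by
  suffices h : ∃ N, ∀ B ∈ Γ, ∀ x, B.FreeRel m x → x < N by
    obtain ⟨N, hN⟩ := h
    exact ⟨N, fun B hB h => lt_irrefl _ (hN B hB N h)⟩
  induction Γ with
  | nil => exact ⟨0, by simp⟩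
  | cons A Γ ih =>
    obtain ⟨N, hN⟩ := ih
    obtain ⟨K, hK⟩ := A.exists_freeRel_lt m
    refine ⟨max N K, List.forall_mem_cons.2 ⟨fun x h => lt_max_of_lt_right (hK x h),
      fun B hB x h => lt_max_of_lt_left (hN B hB x h)⟩⟩

theorem substTm_shift_lift (σ : ℕ → L.Term ℕ) (A : Formula L) :
    (A.substTm shiftTm).substTm (liftTm σ) = (A.substTm σ).substTm shiftTm := by
  rw [substTm_substTm, substTm_substTm]
  congr 1
  funext k
  exact relabel_succ _

theorem substTm_single_subst (σ : ℕ → L.Term ℕ) (a : L.Term ℕ) (A : Formula L) :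
    (A.substTm (singleTm a)).substTm σ =
      (A.substTm (liftTm σ)).substTm (singleTm (a.subst σ)) := by
  rw [substTm_substTm, substTm_substTm]
  congr 1
  funext k
  cases k with
  | zero => rfl
  | succ k =>
    simp only [liftTm, relabel_succ, term_subst_subst]
    exact (term_subst_var _).symm

theorem substHd_shift_lift (m : ℕ) (τ : ∀ n, ℕ → Head L n) (A : Formula L) :
    (A.substHd (shiftHd m)).substHd (liftHd m τ) = (A.substHd τ).substHd (shiftHd m) := by
  rw [substHd_substHd, substHd_substHd]
  congr 1
  funext n k
  by_cases h : n = m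
  · subst h
    simp only [shiftHd, if_true, Head.subst, liftHd]
    cases τ n k <;> simp [Head.succ]
  · simp only [shiftHd, if_false, Head.subst, liftHd, h]
    cases τ n k <;> simp

theorem substHd_single_subst (m : ℕ) (τ : ∀ n, ℕ → Head L n) (Y : Head L m) (A : Formula L) :
    (A.substHd (singleHd m Y)).substHd τ =
      (A.substHd (liftHd m τ)).substHd (singleHd m (Y.subst τ)) := by
  rw [substHd_substHd, substHd_substHd]
  congr 1
  funext n k
  by_cases h : n = m
  · subst h
    cases k with
    | zero => simp [singleHd, liftHd, Head.subst]
    | succ k =>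
      simp only [singleHd, liftHd, if_true, dif_pos, Head.subst]
      cases τ n k <;> simp [Head.succ]
  · simp only [singleHd, liftHd, h, if_false, dif_neg, not_false_iff, Head.subst]
    cases τ n k <;> simp

end Formula

/-! ### Structural properties of the typing system -/

variable {E : Set (L.Term ℕ × L.Term ℕ)} {Γ Γ' : List (Formula L)} {t : Lam} {A : Formula L}

theorem ParticularCase.subst {a b : L.Term ℕ} (h : ParticularCase E a b) (σ : ℕ → L.Term ℕ) :
    ParticularCase E (a.subst σ) (b.subst σ) := by
  obtain ⟨e, he, τ, h⟩ := h
  refine ⟨e, he, fun k => (τ k).subst σ, h.imp ?_ ?_⟩ <;>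
  · rintro ⟨rfl, rfl⟩
    simp only [term_subst_subst, and_self]

theorem ParticularCase.symm {a b : L.Term ℕ} (h : ParticularCase E a b) :
    ParticularCase E b a := by
  obtain ⟨e, he, τ, h⟩ := h
  exact ⟨e, he, τ, h.symm.imp And.symm And.symm⟩

/-- The condition concerns only the variables free in `t`, so weakening and the removal of
irrelevant declarations are both instances. -/
theorem Typed.rename (h : Typed E Γ t A) {ρ : ℕ → ℕ}
    (hρ : ∀ i B, t.Free i → Γ[i]? = some B → Γ'[ρ i]? = some B) :
    Typed E Γ' (t.rename ρ) A := by
  have hmap : ∀ {Γ Γ' : List (Formula L)} {t : Lam} {ρ : ℕ → ℕ} (f : Formula L → Formula L),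
      (∀ i B, t.Free i → Γ[i]? = some B → Γ'[ρ i]? = some B) →
      ∀ i B, t.Free i → (Γ.map f)[i]? = some B → (Γ'.map f)[ρ i]? = some B := by
    intro Γ Γ' t ρ f h i B hi hB
    rw [List.getElem?_map, Option.map_eq_some_iff] at hB
    obtain ⟨C, hC, rfl⟩ := hB
    rw [List.getElem?_map, h i C hi hC, Option.map_some]
  induction h generalizing Γ' ρ with
  | var h => exact .var (hρ _ _ rfl h)
  | lam _ ih =>
    refine .lam (ih ?_)
    rintro (_ | i) B hi hB
    · exact hB
    · exact hρ i B hi hB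
  | app _ _ iht ihs =>
    exact .app (iht fun i B hi => hρ i B (.inl hi)) (ihs fun i B hi => hρ i B (.inr hi))
  | introInd _ ih => exact .introInd (ih (hmap _ hρ))
  | elimInd a _ ih => exact .elimInd a (ih hρ)
  | introRel _ ih => exact .introRel (ih (hmap _ hρ))
  | elimRel Y _ ih => exact .elimRel Y (ih hρ)
  | eqn e _ ih => exact .eqn e (ih hρ)

theorem Typed.change_context (h : Typed E Γ t A)
    (hΓ : ∀ i B, t.Free i → Γ[i]? = some B → Γ'[i]? = some B) : Typed E Γ' t A := by
  have := h.rename (ρ := id) hΓ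
  rwa [Lam.rename_id] at this

theorem Typed.substTm (h : Typed E Γ t A) (σ : ℕ → L.Term ℕ) :
    Typed E (Γ.map (Formula.substTm σ)) t (A.substTm σ) := by
  induction h generalizing σ with
  | var h => exact .var (by rw [List.getElem?_map, h, Option.map_some])
  | lam _ ih => exact .lam (ih σ)
  | app _ _ iht ihs => exact .app (iht σ) (ihs σ)
  | introInd _ ih =>
    refine .introInd ?_
    convert ih (liftTm σ) using 1
    simp only [List.map_map]
    congr 1
    funext B
    exact (Formula.substTm_shift_lift σ B).symm
  | elimInd a _ ih =>
    rw [Formula.substTm_single_subst]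
    exact .elimInd _ (ih σ)
  | introRel _ ih =>
    refine .introRel ?_
    convert ih σ using 1
    simp only [List.map_map]
    congr 1
    funext B
    exact Formula.substHd_substTm _ _ B
  | elimRel Y _ ih =>
    rw [← Formula.substHd_substTm]
    exact .elimRel Y (ih σ)
  | eqn e _ ih =>
    rw [Formula.substTm_single_subst]
    refine .eqn (e.subst σ) ?_
    rw [← Formula.substTm_single_subst]
    exact ih σ

theorem Typed.substHd (h : Typed E Γ t A) (τ : ∀ n, ℕ → Head L n) :
    Typed E (Γ.map (Formula.substHd τ)) t (A.substHd τ) := by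
  induction h generalizing τ with
  | var h => exact .var (by rw [List.getElem?_map, h, Option.map_some])
  | lam _ ih => exact .lam (ih τ)
  | app _ _ iht ihs => exact .app (iht τ) (ihs τ)
  | introInd _ ih =>
    refine .introInd ?_
    convert ih τ using 1
    simp only [List.map_map]
    congr 1
    funext B
    exact (Formula.substHd_substTm _ _ B).symm
  | elimInd a _ ih =>
    rw [Formula.substHd_substTm]
    exact .elimInd _ (ih τ)
  | introRel _ ih =>
    refine .introRel ?_
    convert ih (liftHd _ τ) using 1
    simp only [List.map_map]
    congr 1
    funext B
    exact (Formula.substHd_shift_lift _ τ B).symm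
  | elimRel Y _ ih =>
    rw [Formula.substHd_single_subst]
    exact .elimRel _ (ih τ)
  | eqn e _ ih =>
    rw [Formula.substHd_substTm]
    refine .eqn e ?_
    rw [← Formula.substHd_substTm]
    exact ih τ

/-- Generalization over a variable that is not free in the context. -/
theorem Typed.allInd_of_fresh {y : ℕ} (hΓ : ∀ B ∈ Γ, ¬ B.FreeInd y)
    (hA : ¬ A.allInd.FreeInd y) (h : Typed E Γ t (A.substTm (singleTm (.var y)))) :
    Typed E Γ t A.allInd := by
  -- This substitution sends `y` to the bound variable and raises the others. On the context it is
  -- the plain shift, as `y` is not free there; on the instance of `A` at `y` it undoes the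
  -- instantiation.
  have := h.substTm fun k => if k = y then .var 0 else .var (k + 1)
  refine .introInd ?_
  convert this using 1
  · refine List.map_congr_left fun B hB => Formula.substTm_congr fun x hx => ?_
    rw [if_neg]
    · rfl
    · rintro rfl
      exact hΓ B hB hx
  · rw [Formula.substTm_substTm]
    conv_lhs => rw [← A.substTm_var]
    refine Formula.substTm_congr fun x hx => ?_
    cases x with
    | zero => simp [singleTm, Term.subst]
    | succ x =>
      simp only [singleTm, Term.subst]
      rw [if_neg]
      rintro rfl
      exact hA hx

theorem Typed.allRel_of_fresh {m Y : ℕ} (hΓ : ∀ B ∈ Γ, ¬ B.FreeRel m Y)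
    (hA : ¬ (A.allRel m).FreeRel m Y) (h : Typed E Γ t (A.substHd (singleHd m (.var Y)))) :
    Typed E Γ t (A.allRel m) := by
  have := h.substHd fun n k =>
    if n = m then (if k = Y then .var 0 else .var (k + 1)) else .var k
  refine .introRel ?_
  convert this using 1
  · refine List.map_congr_left fun B hB => Formula.substHd_congr fun n x hx => ?_
    by_cases hn : n = m
    · subst hn
      simp only [shiftHd, if_true]
      rw [if_neg]
      rintro rfl
      exact hΓ B hB hx
    · simp [shiftHd, hn]
  · rw [Formula.substHd_substHd]
    conv_lhs => rw [← A.substHd_var]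
    refine Formula.substHd_congr fun n x hx => ?_
    by_cases hn : n = m
    · subst hn
      cases x with
      | zero => simp [singleHd, Head.subst]
      | succ x =>
        simp only [singleHd, dif_pos, Head.subst, if_true]
        rw [if_neg]
        rintro rfl
        exact hA (by simpa [Formula.FreeRel] using hx)
    · simp [singleHd, Head.subst, hn]

end AF2

namespace AF2
open FirstOrder.Language

variable {L : FirstOrder.Language.{u, v}}

/-! ### Soundness -/

theorem saturated_arrow {G G' : Set Lam} (h : Saturated G') : Saturated (arrow G G') :=
  fun _ _ hs e r hr => h _ _ (hs r hr) (e.app (.refl r))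

theorem saturated_sInter {S : Set (Set Lam)} (h : ∀ G ∈ S, Saturated G) : Saturated (⋂₀ S) :=
  fun _ _ hs e G hG => h G hG _ _ (hs G hG) e

/-- The term model takes all saturated sets as truth values, so its second-order quantifiers also
range over functions that come from no relation variable. -/
theorem adequate_saturated : Adequate {G | Saturated G} where
  saturated _ h := h
  arrow_mem _ _ _ h := saturated_arrow h
  sInter_mem _ h := saturated_sInter h

namespace Model

variable {M : Model.{u, v, w} L}

theorem Interp.ext {I J : M.Interp} (h : ∀ k, I.ind k = J.ind k)
    (h' : ∀ n k, I.rel n k = J.rel n k) : I = J := by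
  cases I
  cases J
  simp only [mk.injEq]
  exact ⟨funext h, funext fun n => funext (h' n)⟩

theorem val_mem (A : Formula L) (I : M.Interp) : val A I ∈ M.R := by
  induction A generalizing I with
  | atom H ts => exact Subtype.property _
  | imp A B ihA ihB => exact M.adequate.arrow_mem _ (ihA I) _ (ihB I)
  | allInd A ih =>
    rw [val, ← Set.sInter_range]
    exact M.adequate.sInter_mem _ (Set.range_subset_iff.2 fun a => ih _)
  | allRel n A ih =>
    rw [val, ← Set.sInter_range]
    exact M.adequate.sInter_mem _ (Set.range_subset_iff.2 fun a => ih _)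

theorem saturated_val (A : Formula L) (I : M.Interp) : Saturated (val A I) :=
  M.adequate.saturated _ (val_mem A I)

theorem termVal_subst (ι : ℕ → M.Carrier) (σ : ℕ → L.Term ℕ) (a : L.Term ℕ) :
    M.termVal ι (a.subst σ) = M.termVal (fun k => M.termVal ι (σ k)) a := by
  induction a with
  | var x => rfl
  | func f ts ih => simp only [Term.subst, termVal, ih]

theorem val_substTm (σ : ℕ → L.Term ℕ) (A : Formula L) (I : M.Interp) :
    val (A.substTm σ) I = val A ⟨fun k => M.termVal I.ind (σ k), I.rel⟩ := by
  induction A generalizing σ I with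
  | atom H ts =>
    simp only [Formula.substTm, val, termVal_subst]
    cases H <;> rfl
  | imp A B ihA ihB => simp only [Formula.substTm, val, ihA, ihB]
  | allInd A ih =>
    simp only [Formula.substTm, val, ih]
    refine Set.iInter_congr fun a => ?_
    congr 2
    funext k
    cases k with
    | zero => rfl
    | succ k =>
      simp only [liftTm, relabel_succ, termVal_subst]
      rfl
  | allRel n A ih =>
    simp only [Formula.substTm, val, ih]
    rfl

theorem val_substHd (τ : ∀ n, ℕ → Head L n) (A : Formula L) (I : M.Interp) :
    val (A.substHd τ) I = val A ⟨I.ind, fun n k => headVal I (τ n k)⟩ := by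
  induction A generalizing τ I with
  | atom H ts => cases H <;> rfl
  | imp A B ihA ihB => simp only [Formula.substHd, val, ihA, ihB]
  | allInd A ih =>
    simp only [Formula.substHd, val, ih]
    refine Set.iInter_congr fun a => ?_
    congr 2
  | allRel m A ih =>
    simp only [Formula.substHd, val, ih]
    refine Set.iInter_congr fun Φ => ?_
    congr 2
    funext n k
    by_cases h : n = m
    · subst h
      cases k with
      | zero => simp [liftHd, headVal, Interp.pushRel]
      | succ k =>
        simp only [liftHd, if_true, Interp.pushRel, dif_pos]
        cases τ n k <;> simp [Head.succ, headVal]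
    · simp only [liftHd, Interp.pushRel, h, if_false, dif_neg, not_false_iff]
      cases τ n k <;> simp [headVal, h]

/-- This serves the vacuous quantifiers of `∀₂⁻` formulas, whose value does not depend on the bound
relation variable. -/
theorem val_congr_rel (A : Formula L) {ι : ℕ → M.Carrier}
    {ρ ρ' : ∀ n : ℕ, ℕ → (Fin n → M.Carrier) → M.R}
    (h : ∀ n X, A.FreeRel n X → ρ n X = ρ' n X) : val A ⟨ι, ρ⟩ = val A ⟨ι, ρ'⟩ := by
  induction A generalizing ι ρ ρ' with
  | atom H ts =>
    cases H with
    | var k => simp only [val, headVal, h _ k ⟨rfl, rfl⟩]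
    | sym P => rfl
  | imp A B ihA ihB =>
    simp only [val]
    rw [ihA fun n x hx => h n x (.inl hx), ihB fun n x hx => h n x (.inr hx)]
  | allInd A ih => exact Set.iInter_congr fun a => ih h
  | allRel m A ih =>
    refine Set.iInter_congr fun Φ => ih ?_
    intro n x hx
    by_cases hn : n = m
    · subst hn
      cases x with
      | zero => simp
      | succ x =>
        simp only [dif_pos]
        exact h n x (by simpa [Formula.FreeRel] using hx)
    · simp only [hn, dif_neg, not_false_iff]
      exact h n x (by simpa [Formula.FreeRel, Ne.symm hn] using hx)

theorem val_substTm_shiftTm (A : Formula L) (I : M.Interp) (a : M.Carrier) :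
    val (A.substTm shiftTm) (I.pushInd a) = val A I := by
  rw [val_substTm]; rfl

theorem val_substHd_shiftHd (m : ℕ) (A : Formula L) (I : M.Interp)
    (Φ : (Fin m → M.Carrier) → M.R) :
    val (A.substHd (shiftHd m)) (I.pushRel m Φ) = val A I := by
  rw [val_substHd]
  congr 1
  cases I
  simp only [Interp.pushRel, Interp.mk.injEq, true_and]
  funext n k
  by_cases h : n = m
  · subst h
    simp [shiftHd, headVal]
  · simp [shiftHd, headVal, h]

theorem val_substTm_singleTm (A : Formula L) (I : M.Interp) (a : L.Term ℕ) :
    val (A.substTm (singleTm a)) I = val A (I.pushInd (M.termVal I.ind a)) := by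
  rw [val_substTm]
  congr 1
  simp only [Interp.pushInd, Interp.mk.injEq, and_true]
  funext k
  cases k <;> rfl

theorem val_substHd_singleHd (m : ℕ) (A : Formula L) (I : M.Interp) (Y : Head L m) :
    val (A.substHd (singleHd m Y)) I = val A (I.pushRel m (headVal I Y)) := by
  rw [val_substHd]
  congr 1
  simp only [Interp.pushRel, Interp.mk.injEq, true_and]
  funext n k
  by_cases h : n = m
  · subst h
    cases k <;> simp [singleHd, headVal]
  · simp [singleHd, headVal, h]

theorem Satisfies.particularCase {E : Set (L.Term ℕ × L.Term ℕ)} (hM : M.Satisfies E)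
    {a b : L.Term ℕ} (h : ParticularCase E a b) (ι : ℕ → M.Carrier) :
    M.termVal ι a = M.termVal ι b := by
  obtain ⟨e, he, σ, ⟨rfl, rfl⟩ | ⟨rfl, rfl⟩⟩ := h <;>
  simp only [termVal_subst, hM e he]

end Model

open Model in
/-- The adequacy of the semantics for the typing system. -/
theorem Typed.subst_mem_val {E : Set (L.Term ℕ × L.Term ℕ)} {Γ : List (Formula L)} {t : Lam}
    {A : Formula L} (h : Typed E Γ t A) {M : Model.{u, v, w} L} (hM : M.Satisfies E)
    (I : M.Interp) {σ : ℕ → Lam} (hσ : ∀ i B, Γ[i]? = some B → σ i ∈ val B I) :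
    t.subst σ ∈ val A I := by
  induction h generalizing I σ with
  | var h => exact hσ _ _ h
  | @lam Γ t A B _ ih =>
    intro s hs
    have key : Lam.subst (Lam.single s) (Lam.subst (Lam.liftSub σ) t) ∈ val B I := by
      rw [Lam.subst_subst]
      refine ih I ?_
      rintro (_ | i) C hC
      · cases hC
        exact hs
      · rw [Lam.liftSub, Lam.subst_single_rename_succ]
        exact hσ i C hC
    exact saturated_val B I _ _ key (.rel _ _ (.beta _ _))
  | app _ _ iht ihs => exact iht I hσ _ (ihs I hσ)
  | introInd _ ih =>
    refine Set.mem_iInter.2 fun a => ih _ fun i B hB => ?_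
    rw [List.getElem?_map, Option.map_eq_some_iff] at hB
    obtain ⟨C, hC, rfl⟩ := hB
    rw [val_substTm_shiftTm]
    exact hσ i C hC
  | elimInd a _ ih =>
    rw [val_substTm_singleTm]
    exact Set.mem_iInter.1 (ih I hσ) _
  | introRel _ ih =>
    refine Set.mem_iInter.2 fun a => ih _ fun i B hB => ?_
    rw [List.getElem?_map, Option.map_eq_some_iff] at hB
    obtain ⟨C, hC, rfl⟩ := hB
    rw [val_substHd_shiftHd]
    exact hσ i C hC
  | elimRel Y _ ih =>
    rw [val_substHd_singleHd]
    exact Set.mem_iInter.1 (ih I hσ) _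
  | eqn e _ ih =>
    have := ih I hσ
    rwa [val_substTm_singleTm, hM.particularCase e, ← val_substTm_singleTm] at this

theorem Typed.mem_interpretation {E : Set (L.Term ℕ × L.Term ℕ)} {t s : Lam} {A : Formula L}
    (h : Typed E [] s A) (e : Lam.BetaEtaEq t s) : t ∈ interpretation.{u, v, w} E A := by
  intro M hM I
  have := h.subst_mem_val hM I (σ := Lam.var) (by simp)
  rw [Lam.subst_var] at this
  exact Model.saturated_val A I _ _ this e

end AF2

namespace AF2
open FirstOrder.Language

variable {L : FirstOrder.Language.{u, v}}

/-! ### Indiscernible terms -/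

section Indiscernible

variable (E : Set (L.Term ℕ × L.Term ℕ))

/-- Two terms are indiscernible if the typing system does not distinguish them. -/
def indiscernible : Setoid (L.Term ℕ) where
  r a b := ∀ (Γ : List (Formula L)) (t : Lam) (A : Formula L),
    Typed E Γ t (A.substTm (singleTm a)) ↔ Typed E Γ t (A.substTm (singleTm b))
  iseqv := ⟨fun _ _ _ _ => Iff.rfl, fun h Γ t A => (h Γ t A).symm,
    fun h h' Γ t A => (h Γ t A).trans (h' Γ t A)⟩

variable {E}

theorem indiscernible_of_particularCase {a b : L.Term ℕ} (h : ParticularCase E a b) :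
    indiscernible E a b :=
  fun _ _ _ => ⟨.eqn h, .eqn h.symm⟩

/-- Indiscernibility allows one term to be replaced at a time. Only finitely many variables are free
in `A`, so finitely many replacements turn `σ` into `σ'`. -/
theorem Typed.substTm_indiscernible {Γ : List (Formula L)} {t : Lam} {A : Formula L}
    {σ σ' : ℕ → L.Term ℕ} (hσ : ∀ k, indiscernible E (σ k) (σ' k))
    (h : Typed E Γ t (A.substTm σ)) : Typed E Γ t (A.substTm σ') := by
  -- The variable `j` is isolated as variable 0, which presents its replacement as an instance of
  -- `singleTm`.
  have step : ∀ (τ : ℕ → L.Term ℕ) (j : ℕ) (a : L.Term ℕ),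
      A.substTm (Function.update τ j a) =
        (A.substTm fun k => if k = j then .var 0 else (τ k).subst shiftTm).substTm
          (singleTm a) := by
    intro τ j a
    rw [Formula.substTm_substTm]
    congr 1
    funext k
    by_cases hk : k = j
    · subst hk
      simp [Term.subst, singleTm]
    · simp only [Function.update_of_ne hk, hk, if_false, term_subst_subst]
      exact (term_subst_var _).symm
  have main : ∀ n, Typed E Γ t (A.substTm fun k => if k < n then σ' k else σ k) := by
    intro n
    induction n with
    | zero => simpa using h
    | succ n ih =>
      have e₁ : (fun k => if k < n then σ' k else σ k) =
          Function.update (fun k => if k < n then σ' k else σ k) n (σ n) := by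
        rw [eq_comm, Function.update_eq_self_iff]
        simp
      have e₂ : (fun k => if k < n + 1 then σ' k else σ k) =
          Function.update (fun k => if k < n then σ' k else σ k) n (σ' n) := by
        funext k
        by_cases hk : k = n
        · subst hk
          simp
        · have : k < n + 1 ↔ k < n := by omega
          simp only [Function.update_of_ne hk, this]
      rw [e₁, step] at ih
      rw [e₂, step]
      exact (hσ n _ _ _).1 ih
  obtain ⟨N, hN⟩ := A.exists_freeInd_lt
  have := main N
  rwa [Formula.substTm_congr (σ' := σ') fun x hx => if_pos (hN x hx)] at this

/-- The substitution of a vector of terms for the first variables. -/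
def vecTm {n : ℕ} (as : Fin n → L.Term ℕ) (k : ℕ) : L.Term ℕ :=
  if h : k < n then as ⟨k, h⟩ else .var (k - n)

theorem vecTm_indiscernible {n : ℕ} {as bs : Fin n → L.Term ℕ}
    (h : ∀ i, indiscernible E (as i) (bs i)) (k : ℕ) :
    indiscernible E (vecTm as k) (vecTm bs k) := by
  by_cases hk : k < n
  · simpa [vecTm, hk] using h ⟨k, hk⟩
  · simp only [vecTm, hk, dif_neg, not_false_iff]
    exact (indiscernible E).refl _

/-- A context around `f(a₁, …, aₙ)` is also a context around the arguments, because indiscernibility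
quantifies over every formula. Congruence therefore needs no typing rule of its own. -/
theorem indiscernible_func {n : ℕ} (f : L.Functions n) {as bs : Fin n → L.Term ℕ}
    (h : ∀ i, indiscernible E (as i) (bs i)) :
    indiscernible E (.func f as) (.func f bs) := by
  have key : ∀ {as bs : Fin n → L.Term ℕ}, (∀ i, indiscernible E (as i) (bs i)) →
      ∀ (Γ : List (Formula L)) (t : Lam) (A : Formula L),
      Typed E Γ t (A.substTm (singleTm (.func f as))) →
      Typed E Γ t (A.substTm (singleTm (.func f bs))) := by
    intro as bs h Γ t A ht
    -- The first `n` variables are reserved for the arguments of `f`; the other variables are raised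
    -- by `n`, and `vecTm` lowers them again.
    have e : ∀ as : Fin n → L.Term ℕ, A.substTm (singleTm (.func f as)) =
        (A.substTm fun k => match k with
          | 0 => .func f fun i : Fin n => .var i
          | k + 1 => .var (k + n)).substTm (vecTm as) := by
      intro as
      rw [Formula.substTm_substTm]
      congr 1
      funext k
      cases k with
      | zero => simp [singleTm, Term.subst, vecTm]
      | succ k => simp [singleTm, Term.subst, vecTm]
    rw [e] at ht ⊢
    exact ht.substTm_indiscernible (vecTm_indiscernible h)
  exact fun Γ t A => ⟨key h Γ t A, key (fun i => (indiscernible E).symm (h i)) Γ t A⟩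

theorem Typed.atom_indiscernible {Γ : List (Formula L)} {t : Lam} {n : ℕ} {H : Head L n}
    {as bs : Fin n → L.Term ℕ} (h : ∀ i, indiscernible E (as i) (bs i))
    (ht : Typed E Γ t (.atom H as)) : Typed E Γ t (.atom H bs) := by
  have e : ∀ as : Fin n → L.Term ℕ, Formula.atom H as =
      (Formula.atom H fun i : Fin n => .var i).substTm (vecTm as) := by
    intro as
    simp [Formula.substTm, Term.subst, vecTm]
  rw [e] at ht ⊢
  exact ht.substTm_indiscernible (vecTm_indiscernible h)

end Indiscernible

/-! ### The term model

The variable `i` of the lambda-calculus is declared to be of type `G i` if `N ≤ i`, and is not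
declared otherwise. -/

section TermModel

variable (E : Set (L.Term ℕ × L.Term ℕ)) (G : ℕ → Formula L) (N : ℕ)

/-- The terms equivalent to a beta-normal term of type `B`. -/
def normalSet (B : Formula L) : Set Lam :=
  {t | ∃ s, Lam.BetaEtaEq t s ∧ s.Normal ∧ (∀ i, s.Free i → N ≤ i) ∧
    ∃ K, Typed E ((List.range K).map G) s B}

/-- The terms equivalent to a beta-normal term of type `B` which is not an abstraction. -/
def neutralSet (B : Formula L) : Set Lam :=
  {t | ∃ s, Lam.BetaEtaEq t s ∧ s.Normal ∧ ¬ s.IsAbs ∧ (∀ i, s.Free i → N ≤ i) ∧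
    ∃ K, Typed E ((List.range K).map G) s B}

variable {E G N}

theorem saturated_normalSet (B : Formula L) : Saturated (normalSet E G N B) := by
  rintro t s ⟨r, h, hr⟩ e
  exact ⟨r, e.trans _ _ _ h, hr⟩

theorem neutralSet_subset_normalSet (B : Formula L) :
    neutralSet E G N B ⊆ normalSet E G N B := by
  rintro t ⟨r, h, hr, -, h'⟩
  exact ⟨r, h, hr, h'⟩

theorem getElem?_map_range {K i : ℕ} {B : Formula L} :
    ((List.range K).map G)[i]? = some B ↔ i < K ∧ G i = B := by
  by_cases h : i < K
  · simp [h]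
  · simp [h]

theorem Typed.change_length {K K' : ℕ} {t : Lam} {A : Formula L}
    (h : Typed E ((List.range K).map G) t A) (hK : ∀ i < K, t.Free i → i < K') :
    Typed E ((List.range K').map G) t A := by
  refine h.change_context fun i B hi hB => ?_
  rw [getElem?_map_range] at hB ⊢
  exact ⟨hK i hB.1 hi, hB.2⟩

theorem var_mem_neutralSet {i : ℕ} (hi : N ≤ i) : .var i ∈ neutralSet E G N (G i) := by
  refine ⟨.var i, .refl _, trivial, id, ?_, i + 1, .var ?_⟩
  · rintro _ rfl
    exact hi
  · rw [getElem?_map_range]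
    exact ⟨i.lt_succ_self, rfl⟩

/-- A head that is not an abstraction keeps the application normal. Both contexts are initial
segments of `G`, so the longer one types both terms. -/
theorem app_mem_neutralSet {A B : Formula L} {t s : Lam} (ht : t ∈ neutralSet E G N (.imp A B))
    (hs : s ∈ normalSet E G N A) : .app t s ∈ neutralSet E G N B := by
  obtain ⟨t', et, nt, at', ft, K, ht⟩ := ht
  obtain ⟨s', es, ns, fs, K', hs⟩ := hs
  refine ⟨.app t' s', et.app es, ⟨nt, at', ns⟩, id, fun i hi => hi.elim (ft i) (fs i),
    max K K', .app (ht.change_length ?_) (hs.change_length ?_)⟩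
  · exact fun i hi _ => lt_max_of_lt_left hi
  · exact fun i hi _ => lt_max_of_lt_right hi

/-- Choose a declared variable `i` of type `A`, not free in `t`. A variable is neutral, so `(t)i`
has a normal typed representative `s`; abstracting `i` in `s` gives a normal term equivalent to `t`
by eta. -/
theorem mem_normalSet_imp (hG : ∀ B n, ∃ i, n ≤ i ∧ G i = B) {A B : Formula L} {t : Lam}
    (h : ∀ s ∈ neutralSet E G N A, .app t s ∈ normalSet E G N B) :
    t ∈ normalSet E G N (.imp A B) := by
  obtain ⟨n, hn⟩ := t.exists_free_lt
  obtain ⟨i, hi, rfl⟩ := hG A (max n N)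
  obtain ⟨s, e, ns, fs, K, hs⟩ := h (.var i) (var_mem_neutralSet (le_of_max_le_right hi))
  -- The renaming that abstracts `i`: it becomes index 0 of the new binder, and all other variables
  -- move up.
  let ρ : ℕ → ℕ := fun k => if k = i then 0 else k + 1
  have hρ : Lam.rename ρ (.app t (.var i)) = .app (t.rename Nat.succ) (.var 0) := by
    simp only [Lam.rename, ρ, if_true]
    congr 1
    refine Lam.rename_congr fun k hk => ?_
    have := hn k hk
    have := le_of_max_le_left hi
    exact if_neg (by omega)
  refine ⟨.lam (s.rename ρ), ?_, Lam.normal_rename.2 ns, ?_, K, .lam (hs.rename ?_)⟩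
  · refine .trans _ _ _ (.symm _ _ (.rel _ _ (.eta t))) ?_
    rw [← hρ]
    exact (e.rename ρ).lam
  · intro j hj
    obtain ⟨k, hk, e⟩ := Lam.free_rename.1 hj
    by_cases hki : k = i
    · simp [ρ, hki] at e
    · simp only [ρ, hki, if_false, Nat.add_right_cancel_iff] at e
      exact e ▸ fs k hk
  · intro k B _ hB
    by_cases hki : k = i
    · subst hki
      simpa [ρ] using (getElem?_map_range.1 hB).2
    · simpa only [ρ, hki, if_false, List.getElem?_cons_succ] using hB

/-- A member of `normalSet` is equivalent to a typed term whose context is determined by the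
free variables of the member. -/
theorem exists_typed_of_mem_normalSet {n : ℕ} {t : Lam} (hn : ∀ i, t.Free i → i < n)
    {B : Formula L} (h : t ∈ normalSet E G N B) :
    ∃ s, Lam.BetaEtaEq t s ∧ s.Normal ∧ (∀ i, s.Free i → N ≤ i ∧ i < n) ∧
      Typed E ((List.range n).map G) s B := by
  obtain ⟨s, e, ns, fs, K, hs⟩ := h
  have hs' : ∀ i, s.Free i → i < n := fun i hi => hn i (ns.free_of_eq e.symm hi)
  exact ⟨s, e, ns, fun i hi => ⟨fs i hi, hs' i hi⟩, hs.change_length fun i _ hi => hs' i hi⟩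

/-- The bound `n` depends on `t` alone, and every instance has a representative typed in the first
`n` declarations. Hence `y` can be chosen fresh for these before the instance at `y` is used. -/
theorem mem_normalSet_allInd {A : Formula L} {t : Lam}
    (h : ∀ y, t ∈ normalSet E G N (A.substTm (singleTm (.var y)))) :
    t ∈ normalSet E G N A.allInd := by
  obtain ⟨n, hn⟩ := t.exists_free_lt
  obtain ⟨y, hy⟩ := Formula.exists_fresh_ind (A.allInd :: (List.range n).map G)
  rw [List.forall_mem_cons] at hy
  obtain ⟨s, e, ns, fs, hs⟩ := exists_typed_of_mem_normalSet hn (h y)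
  exact ⟨s, e, ns, fun i hi => (fs i hi).1, n, hs.allInd_of_fresh hy.2 hy.1⟩

theorem mem_normalSet_allRel {m : ℕ} {A : Formula L} {t : Lam}
    (h : ∀ Y, t ∈ normalSet E G N (A.substHd (singleHd m (.var Y)))) :
    t ∈ normalSet E G N (A.allRel m) := by
  obtain ⟨n, hn⟩ := t.exists_free_lt
  obtain ⟨Y, hY⟩ := Formula.exists_fresh_rel m (A.allRel m :: (List.range n).map G)
  rw [List.forall_mem_cons] at hY
  obtain ⟨s, e, ns, fs, hs⟩ := exists_typed_of_mem_normalSet hn (h Y)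
  exact ⟨s, e, ns, fun i hi => (fs i hi).1, n, hs.allRel_of_fresh hY.2 hY.1⟩

theorem neutralSet_mono {A B : Formula L} (h : ∀ {Γ t}, Typed E Γ t A → Typed E Γ t B) :
    neutralSet E G N A ⊆ neutralSet E G N B := by
  rintro t ⟨s, e, ns, as, fs, K, hs⟩
  exact ⟨s, e, ns, as, fs, K, h hs⟩

theorem normalSet_mono {A B : Formula L} (h : ∀ {Γ t}, Typed E Γ t A → Typed E Γ t B) :
    normalSet E G N A ⊆ normalSet E G N B := by
  rintro t ⟨s, e, ns, fs, K, hs⟩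
  exact ⟨s, e, ns, fs, K, h hs⟩

theorem normalSet_atom_congr {n : ℕ} {H : Head L n} {as bs : Fin n → L.Term ℕ}
    (h : ∀ i, indiscernible E (as i) (bs i)) :
    normalSet E G N (.atom H as) = normalSet E G N (.atom H bs) :=
  (normalSet_mono fun ht => ht.atom_indiscernible h).antisymm
    (normalSet_mono fun ht => ht.atom_indiscernible fun i => (indiscernible E).symm (h i))

variable (E G N)

/-- The truth function of a head in the term model. -/
noncomputable def headFun {n : ℕ} (H : Head L n)
    (cs : Fin n → ULift.{w} (Quotient (indiscernible E))) : {G : Set Lam | Saturated G} :=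
  ⟨normalSet E G N (.atom H fun i => (cs i).down.out), saturated_normalSet _⟩

/-- The term model. -/
noncomputable def termModel : Model.{u, v, max u w} L where
  -- The lift places the carrier in any universe of the form `max u w`.
  Carrier := ULift.{w} (Quotient (indiscernible E))
  nonempty := ⟨⟨Quotient.mk _ (.var 0)⟩⟩
  R := {G | Saturated G}
  adequate := adequate_saturated
  funMap f cs := ⟨Quotient.mk _ (.func f fun i => (cs i).down.out)⟩
  relMap P := headFun E G N (.sym P)

/-- The interpretation in the term model given by substitutions of both kinds. -/
noncomputable def termInterp (σ : ℕ → L.Term ℕ) (τ : ∀ n, ℕ → Head L n) :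
    (termModel.{u, v, w} E G N).Interp where
  ind k := ⟨Quotient.mk _ (σ k)⟩
  rel n k := headFun E G N (τ n k)

variable {E G N}

theorem termVal_termModel (σ : ℕ → L.Term ℕ) (a : L.Term ℕ) :
    (termModel.{u, v, w} E G N).termVal (fun k => ⟨Quotient.mk _ (σ k)⟩) a =
      ⟨Quotient.mk _ (a.subst σ)⟩ := by
  induction a with
  | var x => rfl
  | func f ts ih =>
    simp only [Model.termVal, ih]
    exact congrArg ULift.up (Quotient.sound (indiscernible_func f fun i => Quotient.mk_out _))

theorem termModel_satisfies : (termModel.{u, v, w} E G N).Satisfies E := by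
  intro e he ι
  have hι : ι = fun k => ⟨Quotient.mk _ (ι k).down.out⟩ := by
    funext k
    exact congrArg ULift.up (Quotient.out_eq _).symm
  rw [hι, termVal_termModel, termVal_termModel]
  exact congrArg ULift.up (Quotient.sound
    (indiscernible_of_particularCase ⟨e, he, _, .inl ⟨rfl, rfl⟩⟩))

/-- Atoms with indiscernible arguments have the same inhabitants, so the representatives chosen in
`headFun` are immaterial. -/
theorem headFun_mk {n : ℕ} (H : Head L n) (as : Fin n → L.Term ℕ) :
    (headFun.{u, v, w} E G N H fun i => ⟨Quotient.mk _ (as i)⟩ : Set Lam) =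
      normalSet E G N (.atom H as) :=
  normalSet_atom_congr fun _ => Quotient.mk_out _

theorem val_atom_termModel (σ : ℕ → L.Term ℕ) (τ : ∀ n, ℕ → Head L n) {n : ℕ} (H : Head L n)
    (ts : Fin n → L.Term ℕ) :
    Model.val (.atom H ts) (termInterp.{u, v, w} E G N σ τ) =
      normalSet E G N (((Formula.atom H ts).substTm σ).substHd τ) := by
  have e : Model.headVal (termInterp.{u, v, w} E G N σ τ) H = headFun E G N (H.subst τ) := by
    cases H <;> rfl
  simp only [Model.val, e]
  refine Eq.trans ?_ (headFun_mk.{u, v, w} (H.subst τ) fun i => (ts i).subst σ)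
  congr 2
  funext i
  exact termVal_termModel σ (ts i)

theorem pushInd_termInterp (σ : ℕ → L.Term ℕ) (τ : ∀ n, ℕ → Head L n) (a : L.Term ℕ) :
    (termInterp.{u, v, w} E G N σ τ).pushInd ⟨Quotient.mk _ a⟩ =
      termInterp E G N (fun k => (liftTm σ k).subst (singleTm a)) τ := by
  refine Model.Interp.ext (fun k => ?_) fun _ _ => rfl
  cases k with
  | zero => rfl
  | succ k =>
    simp only [termInterp, liftTm, relabel_succ, term_subst_subst]
    exact congrArg (fun b => ULift.up (Quotient.mk _ b)) (term_subst_var (σ k)).symm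

theorem pushRel_termInterp (σ : ℕ → L.Term ℕ) (τ : ∀ n, ℕ → Head L n) {m : ℕ} (Y : Head L m) :
    (termInterp.{u, v, w} E G N σ τ).pushRel m (headFun E G N Y) =
      termInterp E G N σ (fun n k => (liftHd m τ n k).subst (singleHd m Y)) := by
  refine Model.Interp.ext (fun _ => rfl) fun n k => ?_
  simp only [Model.Interp.pushRel, termInterp]
  by_cases h : n = m
  · subst h
    cases k with
    | zero => simp [liftHd, Head.subst, singleHd]; rfl
    | succ k =>
      simp only [liftHd, if_true]
      cases τ n k <;> simp [Head.succ, Head.subst, singleHd] <;> rfl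
  · simp only [liftHd, h, if_false]
    cases τ n k <;> simp [Head.subst, singleHd, h] <;> rfl

/-- In the term model, a formula with positive second-order quantifiers is at most the set of its
normal inhabitants, and one with negative second-order quantifiers is at least the set of its
neutral inhabitants. -/
theorem val_termModel (hG : ∀ B n, ∃ i, n ≤ i ∧ G i = B) (A : Formula L) (σ : ℕ → L.Term ℕ)
    (τ : ∀ n, ℕ → Head L n) :
    (A.Forall2 true → Model.val A (termInterp.{u, v, w} E G N σ τ) ⊆
      normalSet E G N ((A.substTm σ).substHd τ)) ∧
    (A.Forall2 false → neutralSet E G N ((A.substTm σ).substHd τ) ⊆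
      Model.val A (termInterp.{u, v, w} E G N σ τ)) := by
  induction A generalizing σ τ with
  | atom H ts =>
    rw [val_atom_termModel]
    exact ⟨fun _ => subset_rfl, fun _ => neutralSet_subset_normalSet _⟩
  | imp A B ihA ihB =>
    refine ⟨fun h t ht => ?_, fun h t ht s hs => ?_⟩
    · exact mem_normalSet_imp hG fun s hs =>
        (ihB σ τ).1 h.2 (ht s ((ihA σ τ).2 h.1 hs))
    · exact (ihB σ τ).2 h.2 (app_mem_neutralSet ht ((ihA σ τ).1 h.1 hs))
  | allInd A ih =>
    have e : ∀ a, ((A.substTm fun k => (liftTm σ k).subst (singleTm a)).substHd τ) =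
        ((A.substTm (liftTm σ)).substHd τ).substTm (singleTm a) := fun a => by
      rw [← Formula.substTm_substTm, Formula.substHd_substTm]
    refine ⟨fun h t ht => mem_normalSet_allInd fun y => ?_, fun h t ht =>
      Set.mem_iInter.2 fun c => ?_⟩
    · have := Set.mem_iInter.1 ht ⟨Quotient.mk _ (.var y)⟩
      rw [pushInd_termInterp] at this
      rw [← e]
      exact (ih _ τ).1 h this
    · obtain ⟨c⟩ := c
      obtain ⟨a, rfl⟩ := Quotient.exists_rep c
      rw [pushInd_termInterp]
      refine (ih _ τ).2 h ?_
      rw [e]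
      exact neutralSet_mono (fun h => .elimInd a h) ht
  | allRel m A ih =>
    have e : ∀ Y, ((A.substTm σ).substHd fun n k => (liftHd m τ n k).subst (singleHd m Y)) =
        ((A.substTm σ).substHd (liftHd m τ)).substHd (singleHd m Y) := fun Y =>
      (Formula.substHd_substHd _ _ _).symm
    refine ⟨fun h t ht => mem_normalSet_allRel fun Y => ?_, fun h t ht =>
      Set.mem_iInter.2 fun Φ => ?_⟩
    -- An upper bound only needs the instances at relation variables; the other truth functions can
    -- only shrink the intersection.
    · have := Set.mem_iInter.1 ht (headFun E G N (.var Y))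
      rw [pushRel_termInterp] at this
      rw [← e]
      exact (ih σ _).1 h this
    -- The induction hypothesis speaks only of interpretations given by substitutions, and `Φ` is
    -- arbitrary. As the bound variable does not occur in `A`, `Φ` may be replaced by the truth
    -- function of any head, here variable 0.
    · have hΦ : Model.val A ((termInterp.{u, v, w} E G N σ τ).pushRel m Φ) =
          Model.val A ((termInterp.{u, v, w} E G N σ τ).pushRel m
            (headFun E G N (.var 0))) := by
        refine Model.val_congr_rel A fun n X hX => ?_
        by_cases hn : n = m
        · subst hn
          cases X with
          | zero => exact absurd hX h.2
          | succ X => simp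
        · simp [hn]
      rw [hΦ, pushRel_termInterp]
      refine (ih σ _).2 h.1 ?_
      rw [e]
      exact neutralSet_mono (fun h => .elimRel _ h) ht

end TermModel

/-! ### Completeness over countably many formulas -/

/-- A sequence in which every formula occurs infinitely often. -/
theorem exists_enumeration [Countable (Formula L)] :
    ∃ G : ℕ → Formula L, ∀ B n, ∃ i, n ≤ i ∧ G i = B := by
  have : Nonempty (Formula L) := ⟨.atom (n := 0) (.var 0) fun _ => .var 0⟩
  obtain ⟨f, hf⟩ := exists_surjective_nat (Formula L)
  refine ⟨fun i => f i.unpair.1, fun B n => ?_⟩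
  obtain ⟨k, rfl⟩ := hf B
  exact ⟨Nat.pair k n, Nat.right_le_pair k n, by simp⟩

theorem exists_typed_of_mem_interpretation [Countable (Formula L)]
    {E : Set (L.Term ℕ × L.Term ℕ)} {A : Formula L} (hA : A.Forall2 true) {t : Lam}
    (h : t ∈ interpretation.{u, v, max u w} E A) :
    ∃ s, Lam.BetaEtaEq t s ∧ Typed E [] s A := by
  obtain ⟨G, hG⟩ := exists_enumeration (L := L)
  obtain ⟨N, hN⟩ := t.exists_free_lt
  have := (val_termModel.{u, v, w} (N := N) hG A .var fun _ => .var).1 hA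
    (h _ termModel_satisfies _)
  rw [Formula.substTm_var, Formula.substHd_var] at this
  obtain ⟨s, e, -, fs, hs⟩ := exists_typed_of_mem_normalSet hN this
  -- With `N` bounding the free variables of `t`, those of `s` would be both at least `N` and below
  -- `N`: the term `s` is closed, and its context can be dropped.
  refine ⟨s, e, hs.change_context fun i B hi _ => ?_⟩
  have := fs i hi
  omega

end AF2

namespace AF2
open FirstOrder.Language

/-! ### Countable languages -/

section Countable

variable {L : FirstOrder.Language.{u, v}}

/-- The formulas of height at most `k`. -/
def stage (L : FirstOrder.Language.{u, v}) : ℕ → Set (Formula L)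
  | 0 => Set.range fun p : Σ n, Head L n × (Fin n → L.Term ℕ) => .atom p.2.1 p.2.2
  | k + 1 => stage L k ∪ Set.image2 .imp (stage L k) (stage L k) ∪ .allInd '' stage L k ∪
      ⋃ n, .allRel n '' stage L k

theorem exists_mem_stage (A : Formula L) : ∃ k, A ∈ stage L k := by
  have mono : Monotone (stage L) := monotone_nat_of_le_succ fun k A h => .inl (.inl (.inl h))
  induction A with
  | atom H ts => exact ⟨0, ⟨_, H, ts⟩, rfl⟩
  | imp A B ihA ihB =>
    obtain ⟨k, hk⟩ := ihA
    obtain ⟨l, hl⟩ := ihB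
    exact ⟨max k l + 1, .inl (.inl (.inr ⟨A, mono (le_max_left k l) hk, B,
      mono (le_max_right k l) hl, rfl⟩))⟩
  | allInd A ih =>
    obtain ⟨k, hk⟩ := ih
    exact ⟨k + 1, .inl (.inr ⟨A, hk, rfl⟩)⟩
  | allRel n A ih =>
    obtain ⟨k, hk⟩ := ih
    exact ⟨k + 1, .inr (Set.mem_iUnion.2 ⟨n, A, hk, rfl⟩)⟩

theorem countable_formula [Countable (Σ n, L.Functions n)] [∀ n, Countable (L.Relations n)] :
    Countable (Formula L) := by
  have hH : ∀ n, Countable (Head L n) := fun n => by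
    let f : ℕ ⊕ L.Relations n → Head L n := Sum.elim .var .sym
    refine Function.Surjective.countable (f := f) ?_
    rintro (k | P)
    · exact ⟨.inl k, rfl⟩
    · exact ⟨.inr P, rfl⟩
  have hs : ∀ k, (stage L k).Countable := fun k => by
    induction k with
    | zero => exact Set.countable_range _
    | succ k ih =>
      exact ((ih.union (ih.image2 ih _)).union (ih.image _)).union
        (Set.countable_iUnion fun n => ih.image _)
  rw [← Set.countable_univ_iff]
  exact (Set.countable_iUnion hs).mono fun A _ => Set.mem_iUnion.2 (exists_mem_stage A)

end Countable

/-! ### Change of language -/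

section Map

variable {L K : FirstOrder.Language.{u, v}} (φ : K →ᴸ L)

/-- The image of a head under a map of languages. -/
def Head.map {n : ℕ} : Head K n → Head L n
  | .var k => .var k
  | .sym P => .sym (φ.onRelation P)

/-- The image of a formula under a map of languages. -/
def Formula.map : Formula K → Formula L
  | .atom H ts => .atom (H.map φ) fun i => φ.onTerm (ts i)
  | .imp A B => .imp (map A) (map B)
  | .allInd A => .allInd (map A)
  | .allRel n A => .allRel n (map A)

theorem onTerm_subst (σ : ℕ → K.Term ℕ) (a : K.Term ℕ) :
    φ.onTerm (a.subst σ) = (φ.onTerm a).subst fun k => φ.onTerm (σ k) := by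
  induction a with
  | var x => rfl
  | func f ts ih => simp only [Term.subst, LHom.onTerm, ih]

theorem onTerm_liftTm (σ : ℕ → K.Term ℕ) :
    (fun k => φ.onTerm (liftTm σ k)) = liftTm fun k => φ.onTerm (σ k) := by
  funext k
  cases k with
  | zero => rfl
  | succ k =>
    simp only [liftTm, relabel_succ, onTerm_subst]
    rfl

theorem Head.map_subst (τ : ∀ n, ℕ → Head K n) {n : ℕ} (H : Head K n) :
    (H.subst τ).map φ = (H.map φ).subst fun n k => (τ n k).map φ := by
  cases H <;> rfl

theorem map_liftHd (m : ℕ) (τ : ∀ n, ℕ → Head K n) :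
    (fun n k => (liftHd m τ n k).map φ) = liftHd m fun n k => (τ n k).map φ := by
  funext n k
  by_cases h : n = m
  · subst h
    cases k with
    | zero => simp [liftHd, Head.map]
    | succ k =>
      simp only [liftHd, if_true]
      cases τ n k <;> rfl
  · simp only [liftHd, h, if_false]

theorem map_singleHd (m : ℕ) (Y : Head K m) :
    (fun n k => (singleHd m Y n k).map φ) = singleHd m (Y.map φ) := by
  funext n k
  by_cases h : n = m
  · subst h
    cases k <;> simp [singleHd, Head.map]
  · simp [singleHd, h, Head.map]

theorem map_shiftHd (m : ℕ) :
    (fun n k => (shiftHd (L := K) m n k).map φ) = shiftHd m := by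
  funext n k
  by_cases h : n = m <;> simp [shiftHd, h, Head.map]

theorem onTerm_singleTm (a : K.Term ℕ) :
    (fun k => φ.onTerm (singleTm a k)) = singleTm (φ.onTerm a) := by
  funext k
  cases k <;> rfl

namespace Formula

theorem map_substTm (σ : ℕ → K.Term ℕ) (A : Formula K) :
    (A.substTm σ).map φ = (A.map φ).substTm fun k => φ.onTerm (σ k) := by
  induction A generalizing σ with
  | atom H ts => simp only [substTm, map, onTerm_subst]
  | imp A B ihA ihB => simp only [substTm, map, ihA, ihB]
  | allInd A ih => simp only [substTm, map, ih, onTerm_liftTm]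
  | allRel n A ih => simp only [substTm, map, ih]

theorem map_substHd (τ : ∀ n, ℕ → Head K n) (A : Formula K) :
    (A.substHd τ).map φ = (A.map φ).substHd fun n k => (τ n k).map φ := by
  induction A generalizing τ with
  | atom H ts => simp only [substHd, map, Head.map_subst]
  | imp A B ihA ihB => simp only [substHd, map, ihA, ihB]
  | allInd A ih => simp only [substHd, map, ih]
  | allRel n A ih => simp only [substHd, map, ih, map_liftHd]

theorem freeRel_map {m X : ℕ} {A : Formula K} : (A.map φ).FreeRel m X ↔ A.FreeRel m X := by
  induction A generalizing X with
  | atom H ts => cases H <;> rfl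
  | imp A B ihA ihB => simp only [map, FreeRel, ihA, ihB]
  | allInd A ih => simp only [map, FreeRel, ih]
  | allRel n A ih => simp only [map, FreeRel, ih]

theorem forall2_map {s : Bool} {A : Formula K} : (A.map φ).Forall2 s ↔ A.Forall2 s := by
  induction A generalizing s with
  | atom H ts => simp only [map, Forall2]
  | imp A B ihA ihB => simp only [map, Forall2, ihA, ihB]
  | allInd A ih => simp only [map, Forall2, ih]
  | allRel n A ih => cases s <;> simp only [map, Forall2, ih, freeRel_map]

end Formula

variable {φ}

theorem Typed.map {E : Set (L.Term ℕ × L.Term ℕ)} {E' : Set (K.Term ℕ × K.Term ℕ)}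
    (hE : ∀ e ∈ E', (φ.onTerm e.1, φ.onTerm e.2) ∈ E) {Γ : List (Formula K)} {t : Lam}
    {A : Formula K} (h : Typed E' Γ t A) : Typed E (Γ.map (Formula.map φ)) t (A.map φ) := by
  induction h with
  | var h => exact .var (by rw [List.getElem?_map, h, Option.map_some])
  | lam _ ih => exact .lam ih
  | app _ _ iht ihs => exact .app iht ihs
  | introInd _ ih =>
    refine .introInd ?_
    convert ih using 1
    simp only [List.map_map]
    congr 1
    funext B
    exact (Formula.map_substTm φ shiftTm B).symm
  | elimInd a _ ih =>
    rw [Formula.map_substTm, onTerm_singleTm]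
    exact .elimInd _ ih
  | introRel _ ih =>
    refine .introRel ?_
    convert ih using 1
    simp only [List.map_map]
    congr 1
    funext B
    simp only [Function.comp, Formula.map_substHd, map_shiftHd]
  | elimRel Y _ ih =>
    rw [Formula.map_substHd, map_singleHd]
    exact .elimRel _ ih
  | eqn e _ ih =>
    rw [Formula.map_substTm, onTerm_singleTm] at ih ⊢
    refine .eqn ?_ ih
    obtain ⟨e, he, σ, h⟩ := e
    refine ⟨_, hE e he, fun k => φ.onTerm (σ k), h.imp ?_ ?_⟩ <;>
    · rintro ⟨rfl, rfl⟩
      exact ⟨onTerm_subst _ _ _, onTerm_subst _ _ _⟩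

variable (φ)

open Classical in
/-- The expansion of a model along a map of languages: the symbols that are not in the image are
interpreted trivially. -/
noncomputable def Model.expand (M : Model.{u, v, w} K) : Model.{u, v, w} L where
  Carrier := M.Carrier
  nonempty := M.nonempty
  R := M.R
  adequate := M.adequate
  funMap f cs := if h : ∃ g, φ.onFunction g = f then M.funMap h.choose cs else M.nonempty.some
  relMap P cs := if h : ∃ Q, φ.onRelation Q = P then M.relMap h.choose cs else
    ⟨⋂₀ ∅, M.adequate.sInter_mem _ (Set.empty_subset _)⟩

namespace Model

variable {φ} {M : Model.{u, v, w} K}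

theorem termVal_expand
    (hF : ∀ n, Function.Injective fun f : K.Functions n => φ.onFunction f)
    (ι : ℕ → M.Carrier) (a : K.Term ℕ) :
    (M.expand φ).termVal ι (φ.onTerm a) = M.termVal ι a := by
  induction a with
  | var x => rfl
  | func f ts ih =>
    have h : ∃ g, φ.onFunction g = φ.onFunction f := ⟨f, rfl⟩
    simp only [LHom.onTerm, termVal, ih]
    exact (dif_pos h).trans (by rw [hF _ h.choose_spec])

theorem headVal_expand
    (hR : ∀ n, Function.Injective fun P : K.Relations n => φ.onRelation P)
    (ι : ℕ → M.Carrier) (ρ : ∀ n : ℕ, ℕ → (Fin n → M.Carrier) → M.R) {n : ℕ}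
    (H : Head K n) :
    headVal (M := M.expand φ) ⟨ι, ρ⟩ (H.map φ) = headVal (M := M) ⟨ι, ρ⟩ H := by
  cases H with
  | var k => rfl
  | sym P =>
    have h : ∃ Q, φ.onRelation Q = φ.onRelation P := ⟨P, rfl⟩
    funext cs
    exact (dif_pos h).trans (by rw [hR _ h.choose_spec]; rfl)

/-- The expansion keeps the carrier and the truth values, so quantifiers range over the same sets.
Injectivity on symbols makes the chosen preimage of a symbol the symbol itself. -/
theorem val_expand
    (hF : ∀ n, Function.Injective fun f : K.Functions n => φ.onFunction f)
    (hR : ∀ n, Function.Injective fun P : K.Relations n => φ.onRelation P)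
    (A : Formula K) (ι : ℕ → M.Carrier)
    (ρ : ∀ n : ℕ, ℕ → (Fin n → M.Carrier) → M.R) :
    val (M := M.expand φ) (A.map φ) ⟨ι, ρ⟩ = val (M := M) A ⟨ι, ρ⟩ := by
  induction A generalizing ι ρ with
  | atom H ts =>
    simp only [Formula.map, val, termVal_expand hF, headVal_expand hR]
  | imp A B ihA ihB => simp only [Formula.map, val, ihA, ihB]
  | allInd A ih => exact Set.iInter_congr fun a => ih _ _
  | allRel n A ih => exact Set.iInter_congr fun Φ => ih _ _

end Model

end Map

/-! ### Restriction to countably many symbols -/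

section SubLanguage

variable {L : FirstOrder.Language.{u, v}}

/-- The language consisting of given symbols of `L`. -/
def subLanguage (S : Set (Σ n, L.Functions n)) (T : Set (Σ n, L.Relations n)) :
    FirstOrder.Language.{u, v} where
  Functions n := {f : L.Functions n // ⟨n, f⟩ ∈ S}
  Relations n := {P : L.Relations n // ⟨n, P⟩ ∈ T}

/-- The inclusion of a language consisting of given symbols of `L`. -/
def subLanguageHom (S : Set (Σ n, L.Functions n)) (T : Set (Σ n, L.Relations n)) :
    subLanguage S T →ᴸ L where
  onFunction _ f := f.1
  onRelation _ P := P.1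

theorem countable_formula_subLanguage {S : Set (Σ n, L.Functions n)}
    {T : Set (Σ n, L.Relations n)} (hS : S.Countable) (hT : T.Countable) :
    Countable (Formula (subLanguage S T)) := by
  have := hS.to_subtype
  have := hT.to_subtype
  have : Countable (Σ n, (subLanguage S T).Functions n) := by
    refine Function.Surjective.countable
      (f := fun p : S => (⟨p.1.1, ⟨p.1.2, p.2⟩⟩ : Σ n, (subLanguage S T).Functions n)) ?_
    rintro ⟨n, f, hf⟩
    exact ⟨⟨⟨n, f⟩, hf⟩, rfl⟩
  have : ∀ n, Countable ((subLanguage S T).Relations n) := fun n => by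
    refine Function.Injective.countable
      (f := fun P : (subLanguage S T).Relations n => (⟨⟨n, P.1⟩, P.2⟩ : T)) ?_
    intro P Q h
    simp only [Subtype.mk.injEq, Sigma.mk.injEq, heq_eq_eq, true_and] at h
    exact Subtype.ext h
  exact countable_formula

/-- The statement covers all larger sets of symbols, so that the requirements of several terms can
be met by one union. -/
theorem exists_functions_term (a : L.Term ℕ) : ∃ S : Set (Σ n, L.Functions n), S.Countable ∧
    ∀ S' ⊇ S, ∀ T, ∃ a', (subLanguageHom S' T).onTerm a' = a := by
  induction a with
  | var x => exact ⟨∅, Set.countable_empty, fun S' _ T => ⟨.var x, rfl⟩⟩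
  | @func n f ts ih =>
    choose S hS h using ih
    refine ⟨insert ⟨n, f⟩ (⋃ i, S i), (Set.countable_iUnion hS).insert _, fun S' hS' T => ?_⟩
    choose ts' hts' using fun i => h i S'
      (((Set.subset_iUnion S i).trans (Set.subset_insert _ _)).trans hS') T
    refine ⟨.func (L := subLanguage S' T) ⟨f, hS' (Set.mem_insert _ _)⟩ ts', ?_⟩
    simp only [LHom.onTerm, hts']
    rfl

theorem exists_symbols_formula (A : Formula L) :
    ∃ (S : Set (Σ n, L.Functions n)) (T : Set (Σ n, L.Relations n)), S.Countable ∧ T.Countable ∧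
      ∀ S' ⊇ S, ∀ T' ⊇ T, ∃ A', Formula.map (subLanguageHom S' T') A' = A := by
  induction A with
  | @atom n H ts =>
    choose S hS h using fun i => exists_functions_term (ts i)
    have hH : ∃ T : Set (Σ n, L.Relations n), T.Countable ∧
        ∀ S', ∀ T' ⊇ T, ∃ H', Head.map (subLanguageHom S' T') H' = H := by
      cases H with
      | var k => exact ⟨∅, Set.countable_empty, fun _ _ _ => ⟨.var k, rfl⟩⟩
      | sym P =>
        exact ⟨{⟨n, P⟩}, Set.countable_singleton _, fun S' T' hT' =>
          ⟨.sym (L := subLanguage S' T') ⟨P, hT' rfl⟩, rfl⟩⟩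
    obtain ⟨T, hT, hH⟩ := hH
    refine ⟨⋃ i, S i, T, Set.countable_iUnion hS, hT, fun S' hS' T' hT' => ?_⟩
    choose ts' hts' using fun i => h i S' ((Set.subset_iUnion S i).trans hS') T'
    obtain ⟨H', rfl⟩ := hH S' T' hT'
    exact ⟨.atom H' ts', by simp only [Formula.map, hts']⟩
  | imp A B ihA ihB =>
    obtain ⟨S₁, T₁, hS₁, hT₁, h₁⟩ := ihA
    obtain ⟨S₂, T₂, hS₂, hT₂, h₂⟩ := ihB
    refine ⟨S₁ ∪ S₂, T₁ ∪ T₂, hS₁.union hS₂, hT₁.union hT₂, fun S' hS' T' hT' => ?_⟩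
    obtain ⟨A', rfl⟩ := h₁ S' (Set.subset_union_left.trans hS') T'
      (Set.subset_union_left.trans hT')
    obtain ⟨B', rfl⟩ := h₂ S' (Set.subset_union_right.trans hS') T'
      (Set.subset_union_right.trans hT')
    exact ⟨.imp A' B', rfl⟩
  | allInd A ih =>
    obtain ⟨S, T, hS, hT, h⟩ := ih
    refine ⟨S, T, hS, hT, fun S' hS' T' hT' => ?_⟩
    obtain ⟨A', rfl⟩ := h S' hS' T' hT'
    exact ⟨.allInd A', rfl⟩
  | allRel n A ih =>
    obtain ⟨S, T, hS, hT, h⟩ := ih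
    refine ⟨S, T, hS, hT, fun S' hS' T' hT' => ?_⟩
    obtain ⟨A', rfl⟩ := h S' hS' T' hT'
    exact ⟨.allRel n A', rfl⟩

/-- Completeness for formulas with positive second-order quantifiers. -/
theorem exists_typed_of_countable {E : Set (L.Term ℕ × L.Term ℕ)} (hE : E.Countable)
    {A : Formula L} (hA : A.Forall2 true) {t : Lam}
    (h : t ∈ interpretation.{u, v, max u w} E A) :
    ∃ s, Lam.BetaEtaEq t s ∧ Typed E [] s A := by
  obtain ⟨S₀, T, hS₀, hT, hA'⟩ := exists_symbols_formula A
  choose F hF hF' using exists_functions_term (L := L)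
  -- Function symbols come from `A` and from all equations of `E`; relation symbols come from `A`
  -- only, since equations contain none.
  let S := S₀ ∪ ⋃ e ∈ E, F e.1 ∪ F e.2
  have hS : S.Countable := hS₀.union (hE.biUnion fun e _ => (hF e.1).union (hF e.2))
  have hSE : ∀ e ∈ E, F e.1 ∪ F e.2 ⊆ S := fun e he =>
    (Set.subset_biUnion_of_mem (u := fun e => F e.1 ∪ F e.2) he).trans Set.subset_union_right
  obtain ⟨A', rfl⟩ := hA' S Set.subset_union_left T subset_rfl
  have := countable_formula_subLanguage hS hT
  let φ := subLanguageHom S T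
  have injF : ∀ n, Function.Injective fun f : (subLanguage S T).Functions n => φ.onFunction f :=
    fun _ => Subtype.val_injective
  have injR : ∀ n, Function.Injective fun P : (subLanguage S T).Relations n => φ.onRelation P :=
    fun _ => Subtype.val_injective
  let E' : Set ((subLanguage S T).Term ℕ × (subLanguage S T).Term ℕ) :=
    {e | (φ.onTerm e.1, φ.onTerm e.2) ∈ E}
  -- A model of `E'` expands to a model of `E`, because `S` contains the symbols of every equation
  -- of `E`. Membership in the interpretation over `L` thus descends to the sublanguage.
  have h' : t ∈ interpretation.{u, v, max u w} E' A' := by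
    rintro M hM ⟨ι, ρ⟩
    rw [← Model.val_expand injF injR]
    refine h _ ?_ _
    rintro ⟨a, b⟩ he ι
    obtain ⟨a, rfl⟩ := hF' a S (Set.subset_union_left.trans (hSE _ he)) T
    obtain ⟨b, rfl⟩ := hF' b S (Set.subset_union_right.trans (hSE _ he)) T
    exact (Model.termVal_expand injF ι a).trans
      ((hM (a, b) he ι).trans (Model.termVal_expand injF ι b).symm)
  obtain ⟨s, e, hs⟩ := exists_typed_of_mem_interpretation ((Formula.forall2_map φ).1 hA) h'
  exact ⟨s, e, hs.map fun _ he => he⟩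

end SubLanguage
end AF2

theorem mainTheorem3 {L : FirstOrder.Language.{u, v}}
    (E : Set (L.Term ℕ × L.Term ℕ)) (hE : E.Countable)
    (A : AF2.Formula L) (hclosed : A.Closed) (hpos : A.Forall2 true) (t : AF2.Lam) :
    t ∈ AF2.interpretation.{u, v, max u w} E A ↔
      ∃ t' : AF2.Lam, AF2.Lam.BetaEtaEq t t' ∧ AF2.Typed E [] t' A :=
  ⟨AF2.exists_typed_of_countable.{u, v, w} hE hpos,
    fun ⟨_, e, h⟩ => h.mem_interpretation e⟩
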